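/- Let $\mathbb{T}=[-1,1)$ be the torus of length $2$. For $\sigma>0$ and $T>0$ consider a classical solution $(u,p,\mathcal{D}_t)$, $t\in[0,T)$, of the two-dimensional free boundary incompressible Euler equations with surface tension: the fluid domain $\mathcal{D}_t\subset\mathbb{T}\times(0,\infty)$ is bounded below by the flat bottom $\Gamma_b=\mathbb{T}\times\{0\}$ and above by a moving curve $\Gamma_t$, and $$\partial_t u+u\cdot\nabla u+\nabla p=0,\qquad \nabla\cdot u=0\qquad\text{in }\mathcal{D}_t,$$ $$V=u\cdot\mathcal{N}\quad\text{and}\quad p=\sigma\mathcal{H}\quad\text{on }\Gamma_t,\qquad u_2=0\quad\text{on }\Gamma_b,$$ where $\mathcal{N}$ is the outward unit normal of $\Gamma_t$, $V$ its normal velocity and $\mathcal{H}$ its mean curvature (the tangential divergence of $\mathcal{N}$), with initial domain $\mathcal{D}_0=\mathbb{T}\times(0,2)$. Classical means: $\mathcal{D}_t=\eta(t,\mathcal{D}_0)$ for a motion $\eta$ that is $C^2$ in $(t,a)\in[0,T)\times(\mathbb{T}\times[0,2])$, with $\eta(0,\cdot)=\mathrm{id}$, every $\eta(t,\cdot)$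 being a diffeomorphism of $\mathbb{T}\times[0,2]$ onto $\overline{\mathcal{D}_t}$ that lifts to a map of $\mathbb{R}\times[0,2]$ commuting with the translation by $(2,0)$, maps $\Gamma_b$ into $\Gamma_b$ and $\mathbb{T}\times(0,2]$ into $\mathbb{T}\times(0,\infty)$ (it need not be the particle flow), so that $\Gamma_t=\eta(t,\mathbb{T}\times\{2\})$; $u$ is $C^1$ in $(t,x)$ and $C^2$ in $x$ up to the boundary; $p(t,\cdot)$ is $C^1$ up to the boundary. (In particular this covers $H^s$-solutions with $s\ge4$.) Let $\Omega=\mathbb{T}\times[0,1]$, let $B_{1/2}$ be the open disk of radius $1/2$ centered at the origin, let $K(t)=\frac12\int_{\mathcal{D}_t}|u(t,x)|^2\,dx$, $\omega=\partial_1u_2-\partial_2u_1$ and $\nabla^\perp=(-\partial_2,\partial_1)$. There is a universal constant $C>0$ such that for all $\sigma>0$, all $T>0$ and every such solution on $[0,T)$ whose initial velocity $u(0,\cdot)$ is smooth in $\mathcal{D}_0$ and satisfies $K(0)\le\sigma/20$, the following holds for every $t\in[0,T)$. First, $\Omega\subset\overline{\mathcal{D}_t}$, so that $u(t,\cdot)$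 is defined on $\Omega$. Second, if $\Phi\in C^1(\Omega)\cap C^2(\operatorname{int}\Omega)$ solves $$\Delta\Phi=\omega(t,\cdot)\ \text{ in }\operatorname{int}\Omega,\qquad \Phi=0\ \text{ on }\partial\Omega,$$ and $U=\nabla^\perp\Phi$ and $e=u(t,\cdot)-U$ on $\Omega$, then $e$ is smooth in $B_{1/2}\cap\Omega$ up to its boundary (that is, $C^\infty$ on the closure of $B_{1/2}\cap\Omega$) and $$|\nabla e(x)|\le C\sqrt{K(0)}\qquad\text{for all }x\in B_{1/2}\cap\Omega,$$ that is, $\|\nabla e\|_{L^\infty(B_{1/2}\cap\Omega)}\le C\sqrt{K(0)}$. -/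

import Mathlib

open Set
open scoped ContDiff

noncomputable section

namespace FreeBoundaryEuler

/-- The plane `ℝ²` with its Euclidean norm; a point `x` has the coordinates `x₁ = x 0`, `x₂ = x 1`.
The torus `𝕋 = [-1, 1)` is treated through its universal cover: a function on (a subset of)
`𝕋 × ℝ` is a function on the plane that is invariant under translation by `period = (2, 0)`. -/
abbrev Plane : Type := EuclideanSpace ℝ (Fin 2)

/-- The translation `(2, 0)` that generates the deck group of `ℝ² → 𝕋 × ℝ`. -/
def period : Plane := !₂[2, 0]

/-- First basis vector. -/
def e₁ : Plane := !₂[1, 0]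

/-- Second basis vector. -/
def e₂ : Plane := !₂[0, 1]

/-- A fundamental domain of `ℝ² → 𝕋 × ℝ`; integrals over subsets of `𝕋 × ℝ` are integrals over the
part of the lifted set in this cell. -/
def cell : Set Plane := {x | x 0 ∈ Ico (-1 : ℝ) 1}

/-- The closed strip `𝕋 × [0, h]` (lifted). -/
def closedStrip (h : ℝ) : Set Plane := {x | 0 ≤ x 1 ∧ x 1 ≤ h}

/-- The initial fluid domain `𝒟₀ = 𝕋 × (0, 2)` (lifted). -/
def initialDomain : Set Plane := {x | 0 < x 1 ∧ x 1 < 2}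

/-- The fixed domain `Ω = 𝕋 × [0, 1]` (lifted). -/
def Ω : Set Plane := closedStrip 1

/-! ### Vector calculus in the plane -/

/-- Divergence `∂₁ v₁ + ∂₂ v₂`. -/
def divergence (v : Plane → Plane) (x : Plane) : ℝ :=
  fderiv ℝ v x e₁ 0 + fderiv ℝ v x e₂ 1

/-- Vorticity `∇^⊥ · v = ∂₁ v₂ - ∂₂ v₁`. -/
def vorticity (v : Plane → Plane) (x : Plane) : ℝ :=
  fderiv ℝ v x e₁ 1 - fderiv ℝ v x e₂ 0

/-- The rotated gradient `∇^⊥ Φ = (-∂₂ Φ, ∂₁ Φ)` on a set `s`; at boundary points of `s` the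
derivatives are those within `s`. -/
def perpGradient (s : Set Plane) (Φ : Plane → ℝ) (x : Plane) : Plane :=
  !₂[-(fderivWithin ℝ Φ s x e₂), fderivWithin ℝ Φ s x e₁]

/-! ### Geometry of a parametrized curve that runs in the direction of increasing `x₁` -/

/-- The unit normal `(-γ₂', γ₁') / |γ'|`, the tangent turned by a right angle counterclockwise. For
an upper boundary that is traversed in the direction of increasing `x₁` it points out of the
region below. -/
def unitNormal (γ : ℝ → Plane) (α : ℝ) : Plane :=
  ‖deriv γ α‖⁻¹ • !₂[-(deriv γ α 1), deriv γ α 0]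

/-- The mean curvature, i.e. the tangential divergence of the unit normal `N`:
`τ · ∂_s N` for the unit tangent `τ = γ' / |γ'|` and the arc length derivative `∂_s = |γ'|⁻¹ ∂_α`. -/
def meanCurvature (γ : ℝ → Plane) (α : ℝ) : ℝ :=
  inner ℝ (deriv (unitNormal γ) α) (deriv γ α) / ‖deriv γ α‖ ^ 2

/-! ### The moving fluid domain

The domain at time `t` is the image of `𝒟₀ = 𝕋 × (0, 2)` under `η t`, where `η` is a `C²` motion:
a family of diffeomorphisms that starts at the identity. The motion only describes how the region
moves; it need not be the particle flow. -/

/-- The fluid domain `𝒟_t`. -/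
def fluidDomain (η : ℝ → Plane → Plane) (t : ℝ) : Set Plane := η t '' initialDomain

/-- The closed fluid domain `𝒟_t ∪ Γ_t ∪ Γ_b`. -/
def closedFluidDomain (η : ℝ → Plane → Plane) (t : ℝ) : Set Plane := η t '' closedStrip 2

/-- The parametrization of the free boundary `Γ_t` that the motion induces. -/
def freeBoundary (η : ℝ → Plane → Plane) (t α : ℝ) : Plane := η t !₂[α, 2]

/-- Closed space-time region occupied by the fluid for times in `[0, T)`. -/
def spaceTime (T : ℝ) (η : ℝ → Plane → Plane) : Set (ℝ × Plane) :=
  {q | q.1 ∈ Ico 0 T ∧ q.2 ∈ closedFluidDomain η q.1}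

/-- `η` is a `C²` motion of `𝕋 × [0, 2]` on the time interval `[0, T)`: it starts at the identity,
is a diffeomorphism onto its image at each time, keeps the bottom `Γ_b = 𝕋 × {0}` in
place as a set, and moves everything else (in particular the upper boundary) inside
`𝕋 × (0, ∞)`. -/
structure IsMotion (T : ℝ) (η : ℝ → Plane → Plane) : Prop where
  initial : ∀ a ∈ closedStrip 2, η 0 a = a
  equivariant : ∀ t ∈ Ico 0 T, ∀ a ∈ closedStrip 2, η t (a + period) = η t a + period
  contDiffOn : ContDiffOn ℝ 2 (fun q : ℝ × Plane ↦ η q.1 q.2) (Ico 0 T ×ˢ closedStrip 2)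
  injOn : ∀ t ∈ Ico 0 T, InjOn (η t) (closedStrip 2)
  jacobian_ne_zero : ∀ t ∈ Ico 0 T, ∀ a ∈ closedStrip 2,
    (fderivWithin ℝ (η t) (closedStrip 2) a).det ≠ 0
  bottom : ∀ t ∈ Ico 0 T, ∀ a ∈ closedStrip 2, a 1 = 0 → η t a 1 = 0
  above : ∀ t ∈ Ico 0 T, ∀ a ∈ closedStrip 2, 0 < a 1 → 0 < η t a 1

/-- Classical solutions, on the time interval `[0, T)`, of the two-dimensional free boundary
incompressible Euler equations with surface tension `σ` and with initial fluid domain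
`𝕋 × (0, 2)`. -/
structure IsSolution (σ T : ℝ) (u : ℝ → Plane → Plane) (p : ℝ → Plane → ℝ)
    (η : ℝ → Plane → Plane) : Prop where
  motion : IsMotion T η
  velocity_periodic : ∀ t ∈ Ico 0 T, Function.Periodic (u t) period
  pressure_periodic : ∀ t ∈ Ioo 0 T, Function.Periodic (p t) period
  /-- The velocity is `C¹` in space-time and `C²` in space, up to the boundary. -/
  velocity_contDiffOn : ContDiffOn ℝ 1 (fun q : ℝ × Plane ↦ u q.1 q.2) (spaceTime T η)
  velocity_contDiffOn_space : ∀ t ∈ Ico 0 T, ContDiffOn ℝ 2 (u t) (closedFluidDomain η t)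
  /-- The pressure is `C¹` in space, up to the boundary. -/
  pressure_contDiffOn : ∀ t ∈ Ioo 0 T, ContDiffOn ℝ 1 (p t) (closedFluidDomain η t)
  /-- `∂_t u + u · ∇u + ∇p = 0` in `𝒟_t`. -/
  momentum : ∀ t ∈ Ioo 0 T, ∀ x ∈ fluidDomain η t,
    deriv (fun s ↦ u s x) t + fderiv ℝ (u t) x (u t x) + gradient (p t) x = 0
  /-- `∇ · u = 0` in `𝒟_t`. -/
  incompressible : ∀ t ∈ Ico 0 T, ∀ x ∈ fluidDomain η t, divergence (u t) x = 0
  /-- The normal velocity of `Γ_t` is `u · N`. -/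
  kinematic : ∀ t ∈ Ioo 0 T, ∀ α : ℝ,
    inner ℝ (deriv (fun s ↦ freeBoundary η s α) t) (unitNormal (freeBoundary η t) α) =
      inner ℝ (u t (freeBoundary η t α)) (unitNormal (freeBoundary η t) α)
  /-- `p = σ H` on `Γ_t`. -/
  dynamic : ∀ t ∈ Ioo 0 T, ∀ α : ℝ,
    p t (freeBoundary η t α) = σ * meanCurvature (freeBoundary η t) α
  /-- `u · n = 0` on `Γ_b`, where `n = (0, -1)`. -/
  no_flow : ∀ t ∈ Ico 0 T, ∀ x : Plane, x 1 = 0 → u t x 1 = 0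

/-- The kinetic energy `K(t) = ½ ∫_{𝒟_t} |u(t, x)|² dx`. -/
def kineticEnergy (u : ℝ → Plane → Plane) (η : ℝ → Plane → Plane) (t : ℝ) : ℝ :=
  (1 / 2) * ∫ x in fluidDomain η t ∩ cell, ‖u t x‖ ^ 2

/-! ### The approximate Biot-Savart law -/

/-- `Φ` is the classical solution of `ΔΦ = f` in `Ω`, `Φ = 0` on `∂Ω`, where `Ω = 𝕋 × [0, 1]`. -/
structure IsStreamFunction (f Φ : Plane → ℝ) : Prop where
  periodic : Function.Periodic Φ period
  contDiffOn : ContDiffOn ℝ 1 Φ Ω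
  contDiffOn_interior : ContDiffOn ℝ 2 Φ (interior Ω)
  laplacian_eq : ∀ x ∈ interior Ω, (Laplacian.laplacian Φ : Plane → ℝ) x = f x
  boundary : ∀ x ∈ frontier Ω, Φ x = 0

/-- The error `e = u - U` between the velocity `u` and the approximate velocity `U = ∇^⊥ Φ`. -/
def velocityError (u : Plane → Plane) (Φ : Plane → ℝ) (x : Plane) : Plane :=
  u x - perpGradient Ω Φ x

end FreeBoundaryEuler

end

open FreeBoundaryEuler

noncomputable section

open MeasureTheory Filter Topology

namespace FreeBoundaryEuler

/-! ### The plane in coordinates -/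

/-! Two arguments meet: surface tension keeps the free boundary away from Ω, and inside Ω the error
e is a harmonic field, to which interior estimates apply.

Geometry. The total energy, kinetic energy plus σ times the length L of the free boundary over one
period, is conserved (`IsSolution.energy_conservation`), and so is the area 4 of the fluid per
period (`IsSolution.integral_jac`). Both follow by pulling the integrals back to the fixed labels
and applying the divergence theorem to a Piola transform (`IsMotion.integral_piola`); the pressure
work at the surface is cancelled by the first variation of length
(`IsMotion.integral_deriv_length`). Initially L = 2, and always L ≥ 2, since the curve advances by 2
in one period. Hence K(t) ≤ K(0), while K(0) ≤ σ/20 gives L ≤ 2 + 1/20. Area 4 over width 2 forces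
some point of the free boundary up to height at least 2; if another point were at height at most 1,
the rise and fall between them would make L too long (`IsMotion.two_add_le_boundaryLength`). So the
free boundary stays above height 1, and a connectedness argument puts Ω inside the closed fluid
domain.

Analysis. In the interior of Ω both u and U are divergence free with the same vorticity, so e₁ − i
e₂ is holomorphic; on the bottom e₂ = 0, so it is real there. Schwarz reflection
(`differentiableOn_schwarzReflection`) extends it to the unit disk, which gives smoothness up to the
bottom. Since Φ vanishes on ∂Ω and e has no vorticity, e is orthogonal to U in L², hence ‖e‖² ≤ ‖u‖²
≤ 2K(0) in L²(Ω) (`IsStreamFunction.integral_norm_sq_velocityError_le`). No condition on e at the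
top of Ω is needed. The mean value property and Cauchy's estimate
(`norm_deriv_le_of_integral_ball_le`) turn this L² bound into the gradient bound. -/

/-- The linear identification of `ℝ × ℝ` with the plane. -/
def pt : (ℝ × ℝ) ≃L[ℝ] Plane :=
  (ContinuousLinearEquiv.finTwoArrow ℝ ℝ).symm.trans (EuclideanSpace.equiv (Fin 2) ℝ).symm

@[simp] lemma pt_apply_zero (q : ℝ × ℝ) : pt q 0 = q.1 := by simp [pt]

@[simp] lemma pt_apply_one (q : ℝ × ℝ) : pt q 1 = q.2 := by simp [pt]

lemma pt_eq (x y : ℝ) : pt (x, y) = !₂[x, y] := by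
  ext i; fin_cases i <;> simp

lemma plane_ext {a b : Plane} (h0 : a 0 = b 0) (h1 : a 1 = b 1) : a = b := by
  ext i; fin_cases i <;> assumption

@[simp] lemma e₁_zero : e₁ 0 = 1 := by simp [e₁]
@[simp] lemma e₁_one : e₁ 1 = 0 := by simp [e₁]
@[simp] lemma e₂_zero : e₂ 0 = 0 := by simp [e₂]
@[simp] lemma e₂_one : e₂ 1 = 1 := by simp [e₂]
@[simp] lemma period_zero : period 0 = 2 := by simp [period]
@[simp] lemma period_one : period 1 = 0 := by simp [period]

lemma pt_one_zero : pt (1, 0) = e₁ := plane_ext (by simp) (by simp)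
lemma pt_zero_one : pt (0, 1) = e₂ := plane_ext (by simp) (by simp)

lemma plane_decomp (a : Plane) : a = a 0 • e₁ + a 1 • e₂ := plane_ext (by simp) (by simp)

lemma clm_apply_eq {F : Type*} [NormedAddCommGroup F] [NormedSpace ℝ F] (L : Plane →L[ℝ] F)
    (a : Plane) : L a = a 0 • L e₁ + a 1 • L e₂ := by
  conv_lhs => rw [plane_decomp a]
  simp

lemma inner_plane (a b : Plane) : inner ℝ a b = a 0 * b 0 + a 1 * b 1 := by
  simp [PiLp.inner_apply, Fin.sum_univ_two, mul_comm]

lemma norm_sq_plane (a : Plane) : ‖a‖ ^ 2 = a 0 ^ 2 + a 1 ^ 2 := by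
  simp [EuclideanSpace.norm_sq_eq, Fin.sum_univ_two]

lemma det_plane (L : Plane →L[ℝ] Plane) : L.det = L e₁ 0 * L e₂ 1 - L e₂ 0 * L e₁ 1 := by
  have h : ∀ i, (EuclideanSpace.basisFun (Fin 2) ℝ).toBasis i = ![e₁, e₂] i := by
    intro i
    fin_cases i <;> ext j <;> fin_cases j <;> simp [e₁, e₂]
  rw [ContinuousLinearMap.det,
    ← LinearMap.det_toMatrix (EuclideanSpace.basisFun (Fin 2) ℝ).toBasis, Matrix.det_fin_two]
  simp only [LinearMap.toMatrix_apply, h]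
  simp

lemma measurePreserving_pt : MeasurePreserving pt volume volume := by
  have h1 := (EuclideanSpace.volume_preserving_symm_measurableEquiv_toLp (Fin 2)).symm
  have h2 := (volume_preserving_finTwoArrow ℝ).symm
  exact h1.comp h2

lemma measurableEmbedding_pt : MeasurableEmbedding pt :=
  pt.toHomeomorph.measurableEmbedding

/-! ### Boxes -/

/-- The compact box `[-1, 1] × [0, h]`. -/
def box (h : ℝ) : Set Plane := {x | x 0 ∈ Icc (-1 : ℝ) 1 ∧ x 1 ∈ Icc 0 h}

lemma pt_preimage_box (h : ℝ) : pt ⁻¹' box h = Icc (-1 : ℝ) 1 ×ˢ Icc 0 h := by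
  ext q; simp only [mem_preimage, box, mem_ofPred_eq, pt_apply_zero, pt_apply_one, mem_prod]

lemma isCompact_box (h : ℝ) : IsCompact (box h) := by
  have : box h = pt '' (Icc (-1 : ℝ) 1 ×ˢ Icc 0 h) := by
    rw [← pt_preimage_box, image_preimage_eq _ pt.surjective]
  rw [this]
  exact (isCompact_Icc.prod isCompact_Icc).image pt.continuous

lemma measurableSet_box (h : ℝ) : MeasurableSet (box h) := (isCompact_box h).measurableSet

lemma box_subset (h : ℝ) : box h ⊆ closedStrip h := fun _ hx ↦ hx.2

lemma continuous_coord (i : Fin 2) : Continuous (fun x : Plane ↦ x i) := by fun_prop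

lemma isOpen_initialDomain : IsOpen initialDomain :=
  (isOpen_lt continuous_const (continuous_coord 1)).inter
    (isOpen_lt (continuous_coord 1) continuous_const)

lemma measurableSet_cell : MeasurableSet cell :=
  (continuous_coord 0).measurable measurableSet_Ico

lemma box_eq_inter_ae (h : ℝ) :
    ({x : Plane | 0 < x 1 ∧ x 1 < h} ∩ cell : Set Plane) =ᵐ[volume] box h := by
  have h1 : (pt ⁻¹' ({x : Plane | 0 < x 1 ∧ x 1 < h} ∩ cell) : Set (ℝ × ℝ)) =
      Ico (-1 : ℝ) 1 ×ˢ Ioo 0 h := by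
    ext q; simp [cell]; tauto
  have h2 : (pt ⁻¹' ({x : Plane | 0 < x 1 ∧ x 1 < h} ∩ cell) : Set (ℝ × ℝ)) =ᵐ[volume]
      pt ⁻¹' box h := by
    rw [h1, pt_preimage_box]
    exact Measure.set_prod_ae_eq Ico_ae_eq_Icc Ioo_ae_eq_Icc
  have h3 := measurePreserving_pt.map_eq
  rw [← h3]
  exact measurableEmbedding_pt.ae_map_iff.2 h2

lemma initialDomain_inter_cell_ae : (initialDomain ∩ cell : Set Plane) =ᵐ[volume] box 2 :=
  box_eq_inter_ae 2

lemma setIntegral_box_eq {F : Type*} [NormedAddCommGroup F] [NormedSpace ℝ F] (f : Plane → F)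
    (h : ℝ) : ∫ x in box h, f x = ∫ q in Icc (-1 : ℝ) 1 ×ˢ Icc 0 h, f (pt q) := by
  rw [← pt_preimage_box, measurePreserving_pt.setIntegral_preimage_emb measurableEmbedding_pt]

/-! ### The divergence theorem on a periodic strip -/

/-- Periodicity of `F` cancels the two lateral sides. Derivatives are needed only in the open strip:
integrability of the divergence comes from its continuous extension `d`, so `F` and `G` need not be
C¹ up to the boundary. -/
lemma integral_divergence_box {h : ℝ} (hh : 0 < h) {F G : Plane → ℝ} {F' G' : Plane → Plane →L[ℝ] ℝ}
    {d : Plane → ℝ} (hF : ContinuousOn F (closedStrip h)) (hG : ContinuousOn G (closedStrip h))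
    (hper : ∀ y ∈ Icc 0 h, F !₂[1, y] = F !₂[-1, y])
    (hF' : ∀ x : Plane, 0 < x 1 → x 1 < h → HasFDerivAt F (F' x) x)
    (hG' : ∀ x : Plane, 0 < x 1 → x 1 < h → HasFDerivAt G (G' x) x)
    (hd : ContinuousOn d (closedStrip h))
    (hdiv : ∀ x : Plane, 0 < x 1 → x 1 < h → d x = F' x e₁ + G' x e₂) :
    ∫ x in box h, d x = ∫ α in (-1 : ℝ)..1, (G !₂[α, h] - G !₂[α, 0]) := by
  have hmaps : MapsTo pt (Icc ((-1 : ℝ), (0 : ℝ)) (1, h)) (closedStrip h) := by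
    intro q hq
    rw [← Icc_prod_Icc] at hq
    simpa [closedStrip] using hq.2
  have hFc := hF.comp pt.continuous.continuousOn hmaps
  have hGc := hG.comp pt.continuous.continuousOn hmaps
  have hdc := hd.comp pt.continuous.continuousOn hmaps
  have hae : (Ioo (-1 : ℝ) 1 ×ˢ Ioo 0 h : Set (ℝ × ℝ)) =ᵐ[volume] Icc ((-1 : ℝ), (0 : ℝ)) (1, h) := by
    rw [← Icc_prod_Icc]
    exact Measure.set_prod_ae_eq Ioo_ae_eq_Icc Ioo_ae_eq_Icc
  have hcongr : EqOn (fun q : ℝ × ℝ ↦ ((F' (pt q)).comp (pt : ℝ × ℝ →L[ℝ] Plane)) (1, 0) +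
      ((G' (pt q)).comp (pt : ℝ × ℝ →L[ℝ] Plane)) (0, 1)) (d ∘ pt)
      (Ioo (-1 : ℝ) 1 ×ˢ Ioo 0 h : Set (ℝ × ℝ)) := by
    intro q hq
    simp [pt_one_zero, pt_zero_one, hdiv (pt q) (by simpa using hq.2.1) (by simpa using hq.2.2)]
  have hmeas : MeasurableSet (Ioo (-1 : ℝ) 1 ×ˢ Ioo 0 h : Set (ℝ × ℝ)) :=
    measurableSet_Ioo.prod measurableSet_Ioo
  have key := integral_divergence_prod_Icc_of_hasFDerivAt_of_le (F ∘ pt) (G ∘ pt)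
    (fun q ↦ (F' (pt q)).comp (pt : ℝ × ℝ →L[ℝ] Plane))
    (fun q ↦ (G' (pt q)).comp (pt : ℝ × ℝ →L[ℝ] Plane)) (-1, 0) (1, h)
    ⟨by norm_num, hh.le⟩ hFc hGc ?_ ?_ ?_
  · rw [← setIntegral_congr_set hae, setIntegral_congr_fun hmeas hcongr, setIntegral_congr_set hae]
      at key
    rw [setIntegral_box_eq, Icc_prod_Icc]
    refine key.trans ?_
    have hp : (∫ y in (0 : ℝ)..h, (F ∘ pt) (1, y)) = ∫ y in (0 : ℝ)..h, (F ∘ pt) (-1, y) := by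
      refine intervalIntegral.integral_congr fun y hy ↦ ?_
      rw [uIcc_of_le hh.le] at hy
      simpa [pt_eq] using hper y hy
    simp only
    rw [hp, add_sub_cancel_right, ← intervalIntegral.integral_sub]
    · simp [pt_eq]
    · refine ContinuousOn.intervalIntegrable ?_
      refine hGc.comp (by fun_prop) ?_
      intro x hx
      rw [uIcc_of_le (by norm_num)] at hx
      rw [← Icc_prod_Icc]
      exact ⟨hx, hh.le, le_rfl⟩
    · refine ContinuousOn.intervalIntegrable ?_
      refine hGc.comp (by fun_prop) ?_
      intro x hx
      rw [uIcc_of_le (by norm_num)] at hx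
      rw [← Icc_prod_Icc]
      exact ⟨hx, le_rfl, hh.le⟩
  · intro q hq
    exact (hF' (pt q) (by simpa using hq.2.1) (by simpa using hq.2.2)).comp q pt.hasFDerivAt
  · intro q hq
    exact (hG' (pt q) (by simpa using hq.2.1) (by simpa using hq.2.2)).comp q pt.hasFDerivAt
  · have h1 : IntegrableOn (d ∘ pt) (Icc ((-1 : ℝ), (0 : ℝ)) (1, h)) :=
      hdc.integrableOn_compact isCompact_Icc
    rw [← integrableOn_congr_set_ae hae] at h1 ⊢
    exact (integrableOn_congr_fun hcongr hmeas).2 h1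

/-! ### The time derivative of an integral with parameter, in integrated form -/

/-- The fundamental theorem of calculus for each label, followed by Fubini. The integrated form asks
for the time derivative only in the open interval, which suits equations imposed only at positive
times. -/
lemma setIntegral_sub_eq_integral_deriv {E : Type*} [TopologicalSpace E] [MeasurableSpace E]
    [OpensMeasurableSpace E] [SecondCountableTopology E] [T2Space E]
    (μ : Measure E) [IsFiniteMeasureOnCompacts μ] [SFinite μ] {R : Set E} (hR : IsCompact R)
    {t : ℝ} (ht : 0 ≤ t) {g g' : ℝ → E → ℝ}
    (hg : ContinuousOn (fun q : ℝ × E ↦ g q.1 q.2) (Icc 0 t ×ˢ R))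
    (hg' : ContinuousOn (fun q : ℝ × E ↦ g' q.1 q.2) (Icc 0 t ×ˢ R))
    (hd : ∀ s ∈ Ioo 0 t, ∀ a ∈ R, HasDerivAt (fun s ↦ g s a) (g' s a) s) :
    (∫ a in R, g t a ∂μ) - ∫ a in R, g 0 a ∂μ = ∫ s in (0 : ℝ)..t, ∫ a in R, g' s a ∂μ := by
  have hslice : ∀ f : ℝ → E → ℝ, ContinuousOn (fun q : ℝ × E ↦ f q.1 q.2) (Icc 0 t ×ˢ R) →
      ∀ s ∈ Icc 0 t, IntegrableOn (f s) R μ := by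
    intro f hf s hs
    have : ContinuousOn (f s) R :=
      hf.comp (f := fun a ↦ (s, a)) (by fun_prop) fun a ha ↦ ⟨hs, ha⟩
    exact this.integrableOn_compact hR
  rw [← integral_sub (hslice g hg t ⟨ht, le_rfl⟩) (hslice g hg 0 ⟨le_rfl, ht⟩)]
  have hpt : ∀ a ∈ R, g t a - g 0 a = ∫ s in (0 : ℝ)..t, g' s a := by
    intro a ha
    have c1 : ContinuousOn (fun s ↦ g s a) (Icc 0 t) :=
      hg.comp (f := fun s ↦ (s, a)) (by fun_prop) fun s hs ↦ ⟨hs, ha⟩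
    have c2 : ContinuousOn (fun s ↦ g' s a) (Icc 0 t) :=
      hg'.comp (f := fun s ↦ (s, a)) (by fun_prop) fun s hs ↦ ⟨hs, ha⟩
    rw [intervalIntegral.integral_eq_sub_of_hasDerivAt_of_le ht c1 (fun s hs ↦ hd s hs a ha)]
    exact (c2.mono (by rw [uIcc_of_le ht])).intervalIntegrable
  rw [setIntegral_congr_fun hR.measurableSet hpt]
  simp only [intervalIntegral.integral_of_le ht]
  refine (integral_integral_swap (f := fun s a ↦ g' s a) ?_).symm
  rw [Measure.prod_restrict]
  have := hg'.integrableOn_compact (μ := volume.prod μ) (isCompact_Icc.prod hR)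
  exact this.mono_set (prod_mono_left Ioc_subset_Icc_self)

/-! ### Label space-time -/

/-- Label space-time `[0, T) × (𝕋 × [0, 2])`. -/
def label (T : ℝ) : Set (ℝ × Plane) := Ico 0 T ×ˢ closedStrip 2

lemma convex_closedStrip (h : ℝ) : Convex ℝ (closedStrip h) := by
  have : closedStrip h = (EuclideanSpace.proj (1 : Fin 2) : Plane →L[ℝ] ℝ) ⁻¹' Icc 0 h := by
    ext x; simp [closedStrip]
  rw [this]
  exact (convex_Icc 0 h).linear_preimage (EuclideanSpace.proj (1 : Fin 2) : Plane →L[ℝ] ℝ).toLinearMap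

lemma openStrip_isOpen (h : ℝ) : IsOpen {x : Plane | 0 < x 1 ∧ x 1 < h} :=
  (isOpen_lt continuous_const (continuous_coord 1)).inter
    (isOpen_lt (continuous_coord 1) continuous_const)

lemma closedStrip_mem_nhds {h : ℝ} {x : Plane} (h0 : 0 < x 1) (h1 : x 1 < h) :
    closedStrip h ∈ 𝓝 x :=
  mem_of_superset ((openStrip_isOpen h).mem_nhds ⟨h0, h1⟩) fun _ hy ↦ ⟨hy.1.le, hy.2.le⟩

lemma uniqueDiffOn_closedStrip {h : ℝ} (hh : 0 < h) : UniqueDiffOn ℝ (closedStrip h) := by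
  refine uniqueDiffOn_convex (convex_closedStrip h) ⟨!₂[0, h / 2], ?_⟩
  exact mem_interior_iff_mem_nhds.2 (closedStrip_mem_nhds (by simp; linarith) (by simp; linarith))

lemma uniqueDiffOn_label (T : ℝ) : UniqueDiffOn ℝ (label T) :=
  (uniqueDiffOn_Ico 0 T).prod (uniqueDiffOn_closedStrip two_pos)

lemma label_mem_nhds {T s : ℝ} {a : Plane} (hs : s ∈ Ioo 0 T) (ha : a ∈ initialDomain) :
    label T ∈ 𝓝 (s, a) :=
  prod_mem_nhds (Ico_mem_nhds hs.1 hs.2) (closedStrip_mem_nhds ha.1 ha.2)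

lemma isClosed_closedStrip (h : ℝ) : IsClosed (closedStrip h) :=
  (isClosed_le continuous_const (continuous_coord 1)).inter
    (isClosed_le (continuous_coord 1) continuous_const)

lemma initialDomain_subset : initialDomain ⊆ closedStrip 2 := fun _ ha ↦ ⟨ha.1.le, ha.2.le⟩

section slices

variable {F : Type*} [NormedAddCommGroup F] [NormedSpace ℝ F] {T s : ℝ} {a : Plane}
  {f : ℝ × Plane → F}

lemma hasDerivAt_time (hf : DifferentiableOn ℝ f (label T)) (hs : s ∈ Ioo 0 T)
    (ha : a ∈ closedStrip 2) :
    HasDerivAt (fun s ↦ f (s, a)) (fderivWithin ℝ f (label T) (s, a) (1, 0)) s := by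
  have h1 := (hf (s, a) ⟨Ioo_subset_Ico_self hs, ha⟩).hasFDerivWithinAt
  have h2 : HasDerivWithinAt (fun s : ℝ ↦ (s, a)) ((1 : ℝ), (0 : Plane)) (Ico 0 T) s :=
    ((hasDerivAt_id s).prodMk (hasDerivAt_const s a)).hasDerivWithinAt
  have h3 : MapsTo (fun s : ℝ ↦ (s, a)) (Ico 0 T) (label T) := fun r hr ↦ ⟨hr, ha⟩
  exact (h1.comp_hasDerivWithinAt s h2 h3).hasDerivAt (Ico_mem_nhds hs.1 hs.2)

lemma hasDerivAt_horizontal (hf : DifferentiableOn ℝ f (label T)) (hs : s ∈ Ico 0 T) {y : ℝ}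
    (hy : y ∈ Icc (0 : ℝ) 2) (α : ℝ) :
    HasDerivAt (fun α ↦ f (s, !₂[α, y])) (fderivWithin ℝ f (label T) (s, !₂[α, y]) (0, e₁)) α := by
  have hmem : ∀ α : ℝ, (s, !₂[α, y]) ∈ label T := fun α ↦ ⟨hs, by simpa [closedStrip] using hy⟩
  have h1 := (hf (s, !₂[α, y]) (hmem α)).hasFDerivWithinAt
  have h3 : HasDerivAt (fun α : ℝ ↦ (!₂[α, y] : Plane)) e₁ α := by
    have := pt.hasFDerivAt.comp_hasDerivAt α ((hasDerivAt_id α).prodMk (hasDerivAt_const α y))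
    simpa [Function.comp_def, pt_eq, e₁] using this
  have h2 : HasDerivWithinAt (fun α : ℝ ↦ (s, (!₂[α, y] : Plane))) ((0 : ℝ), e₁) univ α :=
    ((hasDerivAt_const α s).prodMk h3).hasDerivWithinAt
  have := h1.comp_hasDerivWithinAt α h2 fun r _ ↦ hmem r
  rwa [hasDerivWithinAt_univ] at this

lemma hasFDerivWithinAt_space (hf : DifferentiableOn ℝ f (label T)) (hs : s ∈ Ico 0 T)
    (ha : a ∈ closedStrip 2) :
    HasFDerivWithinAt (fun a ↦ f (s, a))
      ((fderivWithin ℝ f (label T) (s, a)).comp (ContinuousLinearMap.inr ℝ ℝ Plane))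
      (closedStrip 2) a := by
  have h1 := (hf (s, a) ⟨hs, ha⟩).hasFDerivWithinAt
  have h2 : HasFDerivWithinAt (fun a : Plane ↦ (s, a)) (ContinuousLinearMap.inr ℝ ℝ Plane)
      (closedStrip 2) a := by
    exact ((hasFDerivAt_const (𝕜 := ℝ) s a).prodMk (hasFDerivAt_id (𝕜 := ℝ) a)).hasFDerivWithinAt
  have h3 : MapsTo (fun a : Plane ↦ (s, a)) (closedStrip 2) (label T) := fun r hr ↦ ⟨hs, hr⟩
  exact h1.comp a h2 h3

lemma hasFDerivAt_space (hf : DifferentiableOn ℝ f (label T)) (hs : s ∈ Ico 0 T)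
    (ha : a ∈ initialDomain) :
    HasFDerivAt (fun a ↦ f (s, a))
      ((fderivWithin ℝ f (label T) (s, a)).comp (ContinuousLinearMap.inr ℝ ℝ Plane)) a :=
  (hasFDerivWithinAt_space hf hs (initialDomain_subset ha)).hasFDerivAt
    (closedStrip_mem_nhds ha.1 ha.2)

lemma contDiffOn_slice {n : WithTop ℕ∞} (hf : ContDiffOn ℝ n f (label T)) (hs : s ∈ Ico 0 T) :
    ContDiffOn ℝ n (fun a ↦ f (s, a)) (closedStrip 2) :=
  hf.comp (f := fun a ↦ (s, a)) (by fun_prop) fun _ ha ↦ ⟨hs, ha⟩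

/-- The additive constant drops out on differentiation, so the derivatives of a merely equivariant
motion are truly periodic. -/
lemma fderivWithin_label_periodic {c : F} (hf : DifferentiableOn ℝ f (label T))
    (hper : ∀ s ∈ Ico 0 T, ∀ a ∈ closedStrip 2, f (s, a + period) = f (s, a) + c)
    (hs : s ∈ Ico 0 T) (ha : a ∈ closedStrip 2) :
    fderivWithin ℝ f (label T) (s, a + period) = fderivWithin ℝ f (label T) (s, a) := by
  have hp : ∀ a ∈ closedStrip 2, a + period ∈ closedStrip 2 := by
    intro a ha
    simpa [closedStrip] using ha
  have h1 := (hf (s, a + period) ⟨hs, hp a ha⟩).hasFDerivWithinAt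
  have h2 : HasFDerivWithinAt (fun q : ℝ × Plane ↦ (q.1, q.2 + period))
      (ContinuousLinearMap.id ℝ (ℝ × Plane)) (label T) (s, a) := by
    have := ((hasFDerivAt_id (𝕜 := ℝ) (s, a)).add_const ((0 : ℝ), period)).hasFDerivWithinAt
      (s := label T)
    refine HasFDerivWithinAt.congr' this (fun q _ ↦ ?_) ⟨hs, ha⟩
    ext <;> simp
  have hm : MapsTo (fun q : ℝ × Plane ↦ (q.1, q.2 + period)) (label T) (label T) :=
    fun q hq ↦ ⟨hq.1, hp q.2 hq.2⟩
  have h3 := HasFDerivWithinAt.comp (s, a) h1 h2 hm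
  have h4 : HasFDerivWithinAt f (fderivWithin ℝ f (label T) (s, a + period)) (label T) (s, a) := by
    have := HasFDerivWithinAt.sub_const c h3
    rw [ContinuousLinearMap.comp_id] at this
    refine HasFDerivWithinAt.congr' this (fun q hq ↦ ?_) ⟨hs, ha⟩
    simp [hper q.1 hq.1 q.2 hq.2]
  exact (h4.fderivWithin (uniqueDiffOn_label T _ ⟨hs, ha⟩)).symm

end slices

/-- Symmetry of second derivatives passes from the interior to boundary points in its closure, which
is what makes it available on the edges of label space-time. -/
lemma fderivWithin_fderivWithin_comm {E F : Type*} [NormedAddCommGroup E] [NormedSpace ℝ E]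
    [NormedAddCommGroup F] [NormedSpace ℝ F] {f : E → F} {S : Set E} {q : E}
    (hf : ContDiffOn ℝ 2 f S) (hS : UniqueDiffOn ℝ S) (hq : q ∈ S) (hq' : q ∈ closure (interior S))
    (v w : E) :
    fderivWithin ℝ (fun q ↦ fderivWithin ℝ f S q v) S q w =
      fderivWithin ℝ (fun q ↦ fderivWithin ℝ f S q w) S q v := by
  have hd : DifferentiableWithinAt ℝ (fderivWithin ℝ f S) S q :=
    (hf.fderivWithin hS (m := 1) (by norm_num)).differentiableOn (by norm_num) q hq
  have h2 : ∀ v w : E, fderivWithin ℝ (fun q ↦ fderivWithin ℝ f S q v) S q w =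
      fderivWithin ℝ (fderivWithin ℝ f S) S q w v := by
    intro v w
    rw [fderivWithin_clm_apply (hS q hq) hd (differentiableWithinAt_const v)]
    simp
  rw [h2, h2]
  exact (hf q hq).isSymmSndFDerivWithinAt (by simp) hS hq' hq _ _

lemma label_subset_closure_interior {T : ℝ} : label T ⊆ closure (interior (label T)) := by
  intro q hq
  have hT : 0 < T := hq.1.1.trans_lt hq.1.2
  have hconv : Convex ℝ (label T) := (convex_Ico 0 T).prod (convex_closedStrip 2)
  rw [hconv.closure_interior_eq_closure_of_nonempty_interior]
  · exact subset_closure hq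
  · refine ⟨(T / 2, !₂[0, 1]), mem_interior_iff_mem_nhds.2 (label_mem_nhds ?_ ?_)⟩
    · constructor <;> linarith
    · simp [initialDomain]

/-! ### Derivatives of the motion -/

/-- The derivative of the motion in the direction `v` of label space-time. -/
def motionDeriv (T : ℝ) (η : ℝ → Plane → Plane) (v : ℝ × Plane) (q : ℝ × Plane) : Plane :=
  fderivWithin ℝ (fun q : ℝ × Plane ↦ η q.1 q.2) (label T) q v

/-- The Jacobian determinant of the motion. -/
def jac (T : ℝ) (η : ℝ → Plane → Plane) (q : ℝ × Plane) : ℝ :=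
  motionDeriv T η (0, e₁) q 0 * motionDeriv T η (0, e₂) q 1 -
    motionDeriv T η (0, e₂) q 0 * motionDeriv T η (0, e₁) q 1

lemma contDiffOn_coord {E : Type*} [NormedAddCommGroup E] [NormedSpace ℝ E] {n : WithTop ℕ∞}
    {f : E → Plane} {S : Set E} (hf : ContDiffOn ℝ n f S) (i : Fin 2) :
    ContDiffOn ℝ n (fun q ↦ f q i) S :=
  (EuclideanSpace.proj i : Plane →L[ℝ] ℝ).contDiff.comp_contDiffOn hf

lemma hasFDerivWithinAt_coord {E : Type*} [NormedAddCommGroup E] [NormedSpace ℝ E]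
    {f : E → Plane} {f' : E →L[ℝ] Plane} {S : Set E} {x : E} (hf : HasFDerivWithinAt f f' S x)
    (i : Fin 2) :
    HasFDerivWithinAt (fun q ↦ f q i) ((EuclideanSpace.proj i : Plane →L[ℝ] ℝ).comp f') S x :=
  (EuclideanSpace.proj i : Plane →L[ℝ] ℝ).hasFDerivAt.comp_hasFDerivWithinAt x hf

lemma hasFDerivAt_coord {E : Type*} [NormedAddCommGroup E] [NormedSpace ℝ E]
    {f : E → Plane} {f' : E →L[ℝ] Plane} {x : E} (hf : HasFDerivAt f f' x) (i : Fin 2) :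
    HasFDerivAt (fun q ↦ f q i) ((EuclideanSpace.proj i : Plane →L[ℝ] ℝ).comp f') x :=
  (EuclideanSpace.proj i : Plane →L[ℝ] ℝ).hasFDerivAt.comp x hf

lemma hasDerivAt_coord {f : ℝ → Plane} {f' : Plane} {x : ℝ} (hf : HasDerivAt f f' x) (i : Fin 2) :
    HasDerivAt (fun q ↦ f q i) (f' i) x :=
  (EuclideanSpace.proj i : Plane →L[ℝ] ℝ).hasFDerivAt.comp_hasDerivAt x hf

lemma fluidDomain_subset {t : ℝ} {η : ℝ → Plane → Plane} :
    fluidDomain η t ⊆ closedFluidDomain η t :=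
  image_mono initialDomain_subset

namespace IsMotion

variable {T t : ℝ} {η : ℝ → Plane → Plane} (hη : IsMotion T η)

include hη

lemma differentiableOn : DifferentiableOn ℝ (fun q : ℝ × Plane ↦ η q.1 q.2) (label T) :=
  hη.contDiffOn.differentiableOn (by norm_num)

lemma contDiffOn_motionDeriv (v : ℝ × Plane) : ContDiffOn ℝ 1 (motionDeriv T η v) (label T) :=
  (ContDiffOn.fderivWithin hη.contDiffOn (uniqueDiffOn_label T) (by norm_num)).clm_apply
    contDiffOn_const

lemma motionDeriv_comm {q : ℝ × Plane} (hq : q ∈ label T) (v w : ℝ × Plane) :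
    fderivWithin ℝ (motionDeriv T η v) (label T) q w =
      fderivWithin ℝ (motionDeriv T η w) (label T) q v :=
  fderivWithin_fderivWithin_comm hη.contDiffOn (uniqueDiffOn_label T) hq
    (label_subset_closure_interior hq) v w

lemma contDiffOn_jac : ContDiffOn ℝ 1 (jac T η) (label T) := by
  have h := fun v i ↦ contDiffOn_coord (hη.contDiffOn_motionDeriv v) i
  exact ((h _ _).mul (h _ _)).sub ((h _ _).mul (h _ _))

lemma motionDeriv_periodic (v : ℝ × Plane) {a : Plane} (ht : t ∈ Ico 0 T) (ha : a ∈ closedStrip 2) :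
    motionDeriv T η v (t, a + period) = motionDeriv T η v (t, a) := by
  rw [motionDeriv, fderivWithin_label_periodic (c := period) hη.differentiableOn hη.equivariant ht ha]
  rfl

lemma jac_periodic {a : Plane} (ht : t ∈ Ico 0 T) (ha : a ∈ closedStrip 2) :
    jac T η (t, a + period) = jac T η (t, a) := by
  simp only [jac, hη.motionDeriv_periodic _ ht ha]

lemma fderivWithin_apply {a : Plane} (ht : t ∈ Ico 0 T) (ha : a ∈ closedStrip 2) (v : Plane) :
    fderivWithin ℝ (η t) (closedStrip 2) a v = motionDeriv T η (0, v) (t, a) := by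
  rw [(hasFDerivWithinAt_space hη.differentiableOn ht ha).fderivWithin
    (uniqueDiffOn_closedStrip two_pos a ha)]
  rfl

lemma det_fderivWithin {a : Plane} (ht : t ∈ Ico 0 T) (ha : a ∈ closedStrip 2) :
    (fderivWithin ℝ (η t) (closedStrip 2) a).det = jac T η (t, a) := by
  rw [det_plane]
  simp only [hη.fderivWithin_apply ht ha, jac]

lemma motionDeriv_zero (hT : 0 < T) {a : Plane} (ha : a ∈ closedStrip 2) (v : Plane) :
    motionDeriv T η (0, v) (0, a) = v := by
  rw [← hη.fderivWithin_apply ⟨le_rfl, hT⟩ ha, fderivWithin_congr (f := id) hη.initial (hη.initial a ha),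
    fderivWithin_id (uniqueDiffOn_closedStrip two_pos a ha)]
  rfl

lemma jac_zero (hT : 0 < T) {a : Plane} (ha : a ∈ closedStrip 2) : jac T η (0, a) = 1 := by
  simp [jac, hη.motionDeriv_zero hT ha]

/-- The Jacobian is continuous and never zero on connected label space-time, and equals 1 at time 0.
-/
lemma jac_pos {a : Plane} (ht : t ∈ Ico 0 T) (ha : a ∈ closedStrip 2) :
    0 < jac T η (t, a) := by
  have hT : 0 < T := ht.1.trans_lt ht.2
  by_contra! hneg
  have hconn : IsPreconnected (label T) :=
    ((convex_Ico 0 T).prod (convex_closedStrip 2)).isPreconnected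
  obtain ⟨q, hq, hq0⟩ := hconn.intermediate_value (a := (t, a)) (b := (0, a)) ⟨ht, ha⟩
    ⟨⟨le_rfl, hT⟩, ha⟩ hη.contDiffOn_jac.continuousOn ⟨hneg, by rw [hη.jac_zero hT ha]; norm_num⟩
  exact hη.jacobian_ne_zero q.1 hq.1 q.2 hq.2 (by rw [hη.det_fderivWithin hq.1 hq.2]; exact hq0)

lemma bottom_tangential (ht : t ∈ Ico 0 T) (α : ℝ) :
    motionDeriv T η (0, e₁) (t, !₂[α, 0]) 1 = 0 := by
  have h := hasDerivAt_coord (hasDerivAt_horizontal hη.differentiableOn ht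
    (y := 0) (by norm_num) α) 1
  have h0 : (fun α ↦ η t !₂[α, 0] 1) = fun _ ↦ (0 : ℝ) := by
    ext α
    exact hη.bottom t ht _ (by simp [closedStrip]) (by simp)
  simp only [h0] at h
  exact h.unique (hasDerivAt_const α 0)

lemma bottom_time (ht : t ∈ Ioo 0 T) (α : ℝ) :
    motionDeriv T η (1, 0) (t, !₂[α, 0]) 1 = 0 := by
  have h := hasDerivAt_coord (hasDerivAt_time hη.differentiableOn ht
    (a := !₂[α, 0]) (by simp [closedStrip])) 1
  have h0 : (fun s ↦ η s !₂[α, 0] 1) =ᶠ[𝓝 t] fun _ ↦ (0 : ℝ) := by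
    filter_upwards [Ico_mem_nhds ht.1 ht.2] with s hs
    exact hη.bottom s hs _ (by simp [closedStrip]) (by simp)
  exact (h.congr_of_eventuallyEq h0.symm).unique (hasDerivAt_const t 0)

/-! ### Topology of the fluid domain -/

lemma contDiffOn_slice (ht : t ∈ Ico 0 T) : ContDiffOn ℝ 2 (η t) (closedStrip 2) :=
  FreeBoundaryEuler.contDiffOn_slice hη.contDiffOn ht

/-- The inverse function theorem; it makes the fluid domain open. -/
lemma map_nhds {a : Plane} (ht : t ∈ Ico 0 T) (ha : a ∈ initialDomain) :
    map (η t) (𝓝 a) = 𝓝 (η t a) := by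
  have hat : ContDiffAt ℝ 2 (η t) a :=
    (hη.contDiffOn_slice ht).contDiffAt (closedStrip_mem_nhds ha.1 ha.2)
  have hdet := hη.jacobian_ne_zero t ht a (initialDomain_subset ha)
  rw [fderivWithin_of_mem_nhds (closedStrip_mem_nhds ha.1 ha.2)] at hdet
  have := hat.hasStrictFDerivAt (by norm_num)
  rw [← ContinuousLinearMap.coe_toContinuousLinearEquivOfDetNeZero _ hdet] at this
  exact this.map_nhds_eq_of_equiv

lemma isOpen_fluidDomain (ht : t ∈ Ico 0 T) : IsOpen (fluidDomain η t) := by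
  rw [isOpen_iff_mem_nhds]
  rintro _ ⟨a, ha, rfl⟩
  rw [← hη.map_nhds ht ha]
  exact image_mem_map (isOpen_initialDomain.mem_nhds ha)

/-- The map (t, a) ↦ (t, η t a) has surjective derivative, hence is open. This upgrades the
regularity of `u` within `spaceTime` to honest differentiability in time and space at interior
points. -/
lemma spaceTime_mem_nhds {a : Plane} (ht : t ∈ Ioo 0 T) (ha : a ∈ initialDomain) :
    spaceTime T η ∈ 𝓝 (t, η t a) := by
  have hat : ContDiffAt ℝ 2 (fun q : ℝ × Plane ↦ η q.1 q.2) (t, a) :=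
    hη.contDiffOn.contDiffAt (label_mem_nhds ht ha)
  have hs := hat.hasStrictFDerivAt (by norm_num)
  have hZ : HasStrictFDerivAt (fun q : ℝ × Plane ↦ (q.1, η q.1 q.2))
      ((ContinuousLinearMap.fst ℝ ℝ Plane).prod
        (fderiv ℝ (fun q : ℝ × Plane ↦ η q.1 q.2) (t, a))) (t, a) :=
    hasStrictFDerivAt_fst.prodMk hs
  have hsurj : ∀ y : Plane, ∃ h : Plane,
      fderiv ℝ (fun q : ℝ × Plane ↦ η q.1 q.2) (t, a) (0, h) = y := by
    intro y
    have hdet := hη.jacobian_ne_zero t (Ioo_subset_Ico_self ht) a (initialDomain_subset ha)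
    refine ⟨(ContinuousLinearMap.toContinuousLinearEquivOfDetNeZero _ hdet).symm y, ?_⟩
    rw [← fderivWithin_of_mem_nhds (label_mem_nhds ht ha)]
    change motionDeriv T η (0, _) (t, a) = y
    rw [← hη.fderivWithin_apply (Ioo_subset_Ico_self ht) (initialDomain_subset ha),
      ← ContinuousLinearMap.toContinuousLinearEquivOfDetNeZero_apply _ hdet]
    simp
  have hmap := hZ.map_nhds_eq_of_surj (by
    rw [LinearMap.range_eq_top]
    rintro ⟨r, y⟩
    obtain ⟨h, hh⟩ := hsurj (y - fderiv ℝ (fun q : ℝ × Plane ↦ η q.1 q.2) (t, a) (r, 0))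
    refine ⟨(r, h), ?_⟩
    have : ((r, h) : ℝ × Plane) = (r, 0) + (0, h) := by simp
    ext1
    · simp
    · change fderiv ℝ (fun q : ℝ × Plane ↦ η q.1 q.2) (t, a) (r, h) = y
      rw [this, map_add, hh]
      abel)
  simp only at hmap
  rw [← hmap]
  refine mem_of_superset (image_mem_map (label_mem_nhds ht ha)) ?_
  rintro _ ⟨q, hq, rfl⟩
  exact ⟨hq.1, mem_image_of_mem _ hq.2⟩

end IsMotion

/-! ### Periods -/

lemma add_zsmul_mem_closedStrip {h : ℝ} {a : Plane} (n : ℤ) :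
    a + n • period ∈ closedStrip h ↔ a ∈ closedStrip h := by
  simp [closedStrip]

lemma existsUnique_add_zsmul_mem_cell (a : Plane) : ∃! n : ℤ, a + n • period ∈ cell := by
  have := existsUnique_add_zsmul_mem_Ico (two_pos : (0 : ℝ) < 2) (a 0) (-1)
  norm_num at this
  simpa [cell] using this

lemma exists_add_zsmul_mem_box {h : ℝ} {a : Plane} (ha : a ∈ closedStrip h) :
    ∃ n : ℤ, a + n • period ∈ box h := by
  obtain ⟨n, hn, -⟩ := existsUnique_add_zsmul_mem_cell a
  exact ⟨n, Ico_subset_Icc_self hn, (add_zsmul_mem_closedStrip n).2 ha⟩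

namespace IsMotion

variable {T t : ℝ} {η : ℝ → Plane → Plane} (hη : IsMotion T η)

include hη

lemma map_add_zsmul (ht : t ∈ Ico 0 T) {a : Plane} (ha : a ∈ closedStrip 2) (n : ℤ) :
    η t (a + n • period) = η t a + n • period := by
  induction n with
  | zero => simp
  | succ k ih =>
    rw [add_zsmul, one_zsmul, ← add_assoc, hη.equivariant t ht _ ((add_zsmul_mem_closedStrip _).2 ha),
      ih, add_assoc]
  | pred k ih =>
    have := hη.equivariant t ht (a + (-(k : ℤ) - 1) • period) ((add_zsmul_mem_closedStrip _).2 ha)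
    rw [add_assoc, ← add_one_zsmul, sub_add_cancel, ih] at this
    rw [← add_right_cancel_iff (a := period), ← this, add_assoc, ← add_one_zsmul, sub_add_cancel]

/-- The displacement η t a − a is periodic, hence bounded. Labels of a convergent sequence of image
points therefore stay in a compact set. -/
lemma isClosed_closedFluidDomain (ht : t ∈ Ico 0 T) : IsClosed (closedFluidDomain η t) := by
  have hc := (hη.contDiffOn_slice ht).continuousOn
  obtain ⟨M, hM⟩ := (isCompact_box 2).exists_bound_of_continuousOn
    (f := fun a ↦ η t a - a) ((hc.mono (box_subset 2)).sub continuousOn_id)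
  have hM' : ∀ a ∈ closedStrip 2, ‖η t a - a‖ ≤ M := by
    intro a ha
    obtain ⟨n, hn⟩ := exists_add_zsmul_mem_box ha
    have := hM _ hn
    rwa [hη.map_add_zsmul ht ha, add_sub_add_right_eq_sub] at this
  refine isClosed_of_closure_subset fun x hx ↦ ?_
  obtain ⟨y, hy, hyx⟩ := mem_closure_iff_seq_limit.1 hx
  choose a ha hay using hy
  obtain ⟨B, hB⟩ := (Metric.isBounded_range_of_tendsto y hyx).exists_norm_le
  have hbdd : ∀ n, a n ∈ Metric.closedBall (0 : Plane) (B + M) ∩ closedStrip 2 := by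
    intro n
    refine ⟨?_, ha n⟩
    rw [mem_closedBall_zero_iff]
    have h1 := hM' (a n) (ha n)
    have h2 := hB (y n) (mem_range_self n)
    rw [hay n] at h1
    calc ‖a n‖ = ‖y n - (y n - a n)‖ := by rw [sub_sub_cancel]
      _ ≤ ‖y n‖ + ‖y n - a n‖ := norm_sub_le _ _
      _ ≤ B + M := add_le_add h2 h1
  obtain ⟨b, hb, φ, hφ, hlim⟩ := ((isCompact_closedBall (0 : Plane) (B + M)).inter_right
    (isClosed_closedStrip 2)).tendsto_subseq hbdd
  refine ⟨b, hb.2, ?_⟩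
  have h1 : Tendsto (fun n ↦ η t (a (φ n))) atTop (𝓝 (η t b)) :=
    (hc b hb.2).tendsto.comp (tendsto_nhdsWithin_iff.2 ⟨hlim, Eventually.of_forall fun n ↦ ha _⟩)
  simp only [hay] at h1
  exact tendsto_nhds_unique h1 (hyx.comp hφ.tendsto_atTop)

/-! ### Change of variables -/

/-- The labels that land in `cell` need not form `cell` themselves. They do form, up to the
extension outside the label strip, another fundamental domain of the same translation group, and the
integral of a periodic function does not see the difference. -/
lemma setIntegral_fluidDomain_inter_cell (ht : t ∈ Ico 0 T) {f : Plane → ℝ}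
    (hf : ∀ x ∈ fluidDomain η t, f (x + period) = f x) :
    ∫ x in fluidDomain η t ∩ cell, f x = ∫ a in box 2, jac T η (t, a) * f (η t a) := by
  classical
  let g : Plane → ℝ := initialDomain.indicator fun a ↦ jac T η (t, a) * f (η t a)
  -- Extending by the identity outside the open strip keeps the map measurable and equivariant on
  -- the whole plane, so the preimage of `cell` is a fundamental domain there.
  let ηt : Plane → Plane := initialDomain.piecewise (η t) id
  have hc : ContinuousOn (η t) initialDomain :=
    (hη.contDiffOn_slice ht).continuousOn.mono initialDomain_subset
  have hmem : ∀ a : Plane, a + period ∈ initialDomain ↔ a ∈ initialDomain := by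
    intro a; simp [initialDomain]
  have hηper : ∀ a : Plane, ηt (a + period) = ηt a + period := by
    intro a
    by_cases ha : a ∈ initialDomain
    · simp only [ηt, piecewise_eq_of_mem _ _ _ ha, piecewise_eq_of_mem _ _ _ ((hmem a).2 ha)]
      exact hη.equivariant t ht a (initialDomain_subset ha)
    · simp [ηt, piecewise_eq_of_notMem _ _ _ ha,
        piecewise_eq_of_notMem _ _ _ (mt (hmem a).1 ha)]
  have hηper' : ∀ (a : Plane) (n : ℤ), ηt (a + n • period) = ηt a + n • period := by
    intro a n
    induction n with
    | zero => simp
    | succ k ih => rw [add_zsmul, one_zsmul, ← add_assoc, hηper, ih, add_assoc]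
    | pred k ih =>
      have := hηper (a + (-(k : ℤ) - 1) • period)
      rw [add_assoc, ← add_one_zsmul, sub_add_cancel, ih] at this
      rw [← add_right_cancel_iff (a := period), ← this, add_assoc, ← add_one_zsmul, sub_add_cancel]
  have hgper : Function.Periodic g period := by
    intro a
    by_cases ha : a ∈ initialDomain
    · simp only [g, indicator_of_mem ha, indicator_of_mem ((hmem a).2 ha)]
      rw [hη.jac_periodic ht (initialDomain_subset ha),
        hη.equivariant t ht a (initialDomain_subset ha), hf _ (mem_image_of_mem _ ha)]
    · simp only [g, indicator_of_notMem ha, indicator_of_notMem (mt (hmem a).1 ha)]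
  have hmeas : Measurable ηt := by
    refine measurable_of_restrict_of_restrict_compl isOpen_initialDomain.measurableSet ?_ ?_
    · have : initialDomain.domRestrict ηt = initialDomain.domRestrict (η t) := by
        simp [ηt]
      rw [this]
      exact hc.domRestrict.measurable
    · have : initialDomainᶜ.domRestrict ηt = initialDomainᶜ.domRestrict id := by
        simp [ηt]
      rw [this]
      exact continuous_id.continuousOn.domRestrict.measurable
  have hcell : ∀ (m : Plane → Plane) (_ : Measurable m)
      (_ : ∀ (a : Plane) (n : ℤ), m (a + n • period) = m a + n • period),
      IsAddFundamentalDomain (AddSubgroup.zmultiples period) (m ⁻¹' cell) volume := by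
    intro m hm hmp
    refine IsAddFundamentalDomain.mk' (hm measurableSet_cell).nullMeasurableSet fun x ↦ ?_
    obtain ⟨n, hn, hu⟩ := existsUnique_add_zsmul_mem_cell (m x)
    refine ⟨⟨n • period, ⟨n, rfl⟩⟩, ?_, ?_⟩
    · change m (n • period + x) ∈ cell
      rwa [add_comm, hmp]
    · rintro ⟨_, ⟨k, rfl⟩⟩ hk
      change m (k • period + x) ∈ cell at hk
      rw [add_comm, hmp] at hk
      simp [hu k hk]
  have hfund : ∫ a in ηt ⁻¹' cell, g a = ∫ a in cell, g a := by
    refine (hcell ηt hmeas hηper').setIntegral_eq (hcell id measurable_id fun _ _ ↦ rfl) ?_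
    rintro ⟨_, ⟨k, rfl⟩⟩ x
    change g (k • period + x) = g x
    rw [add_comm]
    exact hgper.zsmul k x
  have himage : fluidDomain η t ∩ cell = η t '' (ηt ⁻¹' cell ∩ initialDomain) := by
    ext x
    constructor
    · rintro ⟨⟨a, ha, rfl⟩, hx⟩
      exact ⟨a, ⟨by simpa [ηt, piecewise_eq_of_mem _ _ _ ha] using hx, ha⟩, rfl⟩
    · rintro ⟨a, ⟨hx, ha⟩, rfl⟩
      exact ⟨mem_image_of_mem _ ha, by simpa [ηt, piecewise_eq_of_mem _ _ _ ha] using hx⟩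
  have hm1 : MeasurableSet (ηt ⁻¹' cell ∩ initialDomain) :=
    (hmeas measurableSet_cell).inter isOpen_initialDomain.measurableSet
  rw [himage, integral_image_eq_integral_abs_det_fderiv_smul volume hm1
    (f' := fun a ↦ fderivWithin ℝ (η t) (closedStrip 2) a)]
  · calc ∫ a in ηt ⁻¹' cell ∩ initialDomain,
          |(fderivWithin ℝ (η t) (closedStrip 2) a).det| • f (η t a)
        = ∫ a in ηt ⁻¹' cell ∩ initialDomain, jac T η (t, a) * f (η t a) := by
          refine setIntegral_congr_fun hm1 fun a ha ↦ ?_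
          have ha' := initialDomain_subset ha.2
          simp only [hη.det_fderivWithin ht ha', abs_of_pos (hη.jac_pos ht ha'), smul_eq_mul]
      _ = ∫ a in ηt ⁻¹' cell, g a :=
          (setIntegral_indicator isOpen_initialDomain.measurableSet).symm
      _ = ∫ a in cell ∩ initialDomain, jac T η (t, a) * f (η t a) := by
          rw [hfund, setIntegral_indicator isOpen_initialDomain.measurableSet]
      _ = _ := by
          rw [inter_comm]
          exact setIntegral_congr_set initialDomain_inter_cell_ae
  · intro a ha
    exact (((hη.contDiffOn_slice ht).differentiableOn (by norm_num)) a
      (initialDomain_subset ha.2)).hasFDerivWithinAt.mono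
        (inter_subset_right.trans initialDomain_subset)
  · exact (hη.injOn t ht).mono (inter_subset_right.trans initialDomain_subset)

end IsMotion

lemma coordL_apply (i : Fin 2) (x : Plane) :
    (EuclideanSpace.proj i : Plane →L[ℝ] ℝ) x = x i := rfl

lemma horizontal_mem {y : ℝ} (hy : y ∈ Icc (0 : ℝ) 2) (α : ℝ) : !₂[α, y] ∈ closedStrip 2 := by
  simpa [closedStrip] using hy

lemma add_period_eq (α y : ℝ) : (!₂[α, y] : Plane) + period = !₂[α + 2, y] :=
  plane_ext (by simp) (by simp)

/-! ### The divergence theorem and the Jacobian in label coordinates -/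

namespace IsMotion

variable {T t : ℝ} {η : ℝ → Plane → Plane} (hη : IsMotion T η)

include hη

/-- The divergence theorem in label coordinates: `d` is the divergence of the Piola transform
of `G`, and the right-hand side its flux through the boundary. -/
lemma integral_piola (ht : t ∈ Ico 0 T) {G : Plane → Plane} {G' : Plane → Plane →L[ℝ] Plane}
    {d : Plane → ℝ} (hG : ContinuousOn G (closedStrip 2))
    (hper : ∀ a ∈ closedStrip 2, G (a + period) = G a)
    (hG' : ∀ a ∈ initialDomain, HasFDerivAt G (G' a) a) (hd : ContinuousOn d (closedStrip 2))
    (hdiv : ∀ a ∈ initialDomain, d a =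
      G' a e₁ 0 * motionDeriv T η (0, e₂) (t, a) 1 - G' a e₁ 1 * motionDeriv T η (0, e₂) (t, a) 0 -
      G' a e₂ 0 * motionDeriv T η (0, e₁) (t, a) 1 +
      G' a e₂ 1 * motionDeriv T η (0, e₁) (t, a) 0) :
    ∫ a in box 2, d a = ∫ α in (-1 : ℝ)..1,
      ((motionDeriv T η (0, e₁) (t, !₂[α, 2]) 0 * G !₂[α, 2] 1 -
        motionDeriv T η (0, e₁) (t, !₂[α, 2]) 1 * G !₂[α, 2] 0) -
       (motionDeriv T η (0, e₁) (t, !₂[α, 0]) 0 * G !₂[α, 0] 1 -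
        motionDeriv T η (0, e₁) (t, !₂[α, 0]) 1 * G !₂[α, 0] 0)) := by
  have hm : ∀ (v : ℝ × Plane) (i : Fin 2),
      ContinuousOn (fun a ↦ motionDeriv T η v (t, a) i) (closedStrip 2) := fun v i ↦
    (contDiffOn_coord (FreeBoundaryEuler.contDiffOn_slice (hη.contDiffOn_motionDeriv v) ht)
      i).continuousOn
  have hGi : ∀ i : Fin 2, ContinuousOn (fun a ↦ G a i) (closedStrip 2) := fun i ↦
    (continuous_coord i).comp_continuousOn hG
  have hm' : ∀ (v : ℝ × Plane) (i : Fin 2), ∀ a ∈ initialDomain, HasFDerivAt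
      (fun a ↦ motionDeriv T η v (t, a) i) _ a := fun v i a ha ↦ hasFDerivAt_coord
    (hasFDerivAt_space ((hη.contDiffOn_motionDeriv v).differentiableOn (by norm_num)) ht ha) i
  have hF : ∀ a ∈ initialDomain, HasFDerivAt (fun a ↦ G a 0 * motionDeriv T η (0, e₂) (t, a) 1 -
      G a 1 * motionDeriv T η (0, e₂) (t, a) 0) _ a := fun a ha ↦
    ((hasFDerivAt_coord (hG' a ha) 0).mul (hm' (0, e₂) 1 a ha)).sub
      ((hasFDerivAt_coord (hG' a ha) 1).mul (hm' (0, e₂) 0 a ha))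
  have hH : ∀ a ∈ initialDomain, HasFDerivAt (fun a ↦ motionDeriv T η (0, e₁) (t, a) 0 * G a 1 -
      motionDeriv T η (0, e₁) (t, a) 1 * G a 0) _ a := fun a ha ↦
    ((hm' (0, e₁) 0 a ha).mul (hasFDerivAt_coord (hG' a ha) 1)).sub
      ((hm' (0, e₁) 1 a ha).mul (hasFDerivAt_coord (hG' a ha) 0))
  refine integral_divergence_box two_pos (((hGi 0).mul (hm (0, e₂) 1)).sub
    ((hGi 1).mul (hm (0, e₂) 0))) (((hm (0, e₁) 0).mul (hGi 1)).sub
    ((hm (0, e₁) 1).mul (hGi 0))) ?_ (fun a h0 h1 ↦ (hF a ⟨h0, h1⟩).differentiableAt.hasFDerivAt)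
    (fun a h0 h1 ↦ (hH a ⟨h0, h1⟩).differentiableAt.hasFDerivAt) hd ?_
  · intro y hy
    have h1 : (!₂[1, y] : Plane) = !₂[-1, y] + period := by
      rw [add_period_eq]; norm_num
    have h2 := horizontal_mem hy (-1)
    simp only [Pi.sub_apply, Pi.mul_apply, h1, hper _ h2, hη.motionDeriv_periodic _ ht h2]
  · intro a h0 h1
    have hq : (t, a) ∈ label T := ⟨ht, h0.le, h1.le⟩
    rw [(hF a ⟨h0, h1⟩).fderiv, (hH a ⟨h0, h1⟩).fderiv, hdiv a ⟨h0, h1⟩]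
    -- The Piola identity: the second derivatives of η that arise cancel once the mixed ones are
    -- identified.
    have hc := hη.motionDeriv_comm hq (0, e₁) (0, e₂)
    simp only [add_apply, sub_apply,
      smul_apply, ContinuousLinearMap.comp_apply, ContinuousLinearMap.inr_apply,
      coordL_apply, smul_eq_mul, hc]
    ring

lemma fderivWithin_jac {q : ℝ × Plane} (hq : q ∈ label T) (v : ℝ × Plane) :
    fderivWithin ℝ (jac T η) (label T) q v =
      fderivWithin ℝ (motionDeriv T η v) (label T) q (0, e₁) 0 * motionDeriv T η (0, e₂) q 1 +
      motionDeriv T η (0, e₁) q 0 * fderivWithin ℝ (motionDeriv T η v) (label T) q (0, e₂) 1 -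
      fderivWithin ℝ (motionDeriv T η v) (label T) q (0, e₂) 0 * motionDeriv T η (0, e₁) q 1 -
      motionDeriv T η (0, e₂) q 0 * fderivWithin ℝ (motionDeriv T η v) (label T) q (0, e₁) 1 := by
  have hm : ∀ (v : ℝ × Plane) (i : Fin 2), HasFDerivWithinAt
      (fun q ↦ motionDeriv T η v q i) _ (label T) q := fun v i ↦ hasFDerivWithinAt_coord
    (((hη.contDiffOn_motionDeriv v).differentiableOn (by norm_num)) q hq).hasFDerivWithinAt i
  have hJ : HasFDerivWithinAt (jac T η) _ (label T) q :=
    ((hm (0, e₁) 0).mul (hm (0, e₂) 1)).sub ((hm (0, e₂) 0).mul (hm (0, e₁) 1))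
  rw [hJ.fderivWithin (uniqueDiffOn_label T q hq)]
  simp only [add_apply, sub_apply,
    smul_apply, ContinuousLinearMap.comp_apply,
    coordL_apply, smul_eq_mul, hη.motionDeriv_comm hq _ v]
  ring

end IsMotion

/-! ### The velocity in label coordinates -/

/-- The velocity in label coordinates. -/
def labelVelocity (u η : ℝ → Plane → Plane) (q : ℝ × Plane) : Plane := u q.1 (η q.1 q.2)

/-- The kinetic energy density in label coordinates. -/
def labelEnergy (T : ℝ) (u η : ℝ → Plane → Plane) (q : ℝ × Plane) : ℝ :=
  jac T η q * (1 / 2 * (labelVelocity u η q 0 ^ 2 + labelVelocity u η q 1 ^ 2))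

namespace IsSolution

variable {σ T t : ℝ} {u : ℝ → Plane → Plane} {p : ℝ → Plane → ℝ} {η : ℝ → Plane → Plane}
  (hs : IsSolution σ T u p η)

include hs

lemma contDiffOn_labelVelocity : ContDiffOn ℝ 1 (labelVelocity u η) (label T) := by
  have h : ContDiffOn ℝ 1 (fun q : ℝ × Plane ↦ (q.1, η q.1 q.2)) (label T) :=
    contDiffOn_fst.prodMk (hs.motion.contDiffOn.of_le (by norm_num))
  exact hs.velocity_contDiffOn.comp h fun q hq ↦ ⟨hq.1, mem_image_of_mem _ hq.2⟩

lemma labelVelocity_periodic {a : Plane} (ht : t ∈ Ico 0 T) (ha : a ∈ closedStrip 2) :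
    labelVelocity u η (t, a + period) = labelVelocity u η (t, a) := by
  simp only [labelVelocity, hs.motion.equivariant t ht a ha]
  exact hs.velocity_periodic t ht _

lemma contDiffOn_labelEnergy : ContDiffOn ℝ 1 (labelEnergy T u η) (label T) := by
  have h := contDiffOn_coord hs.contDiffOn_labelVelocity
  exact hs.motion.contDiffOn_jac.mul (contDiffOn_const.mul (((h 0).pow 2).add ((h 1).pow 2)))

lemma hasFDerivAt_velocity {a : Plane} (ht : t ∈ Ioo 0 T) (ha : a ∈ initialDomain) :
    HasFDerivAt (fun q : ℝ × Plane ↦ u q.1 q.2)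
      (fderiv ℝ (fun q : ℝ × Plane ↦ u q.1 q.2) (t, η t a)) (t, η t a) :=
  ((hs.velocity_contDiffOn.contDiffAt (hs.motion.spaceTime_mem_nhds ht ha)).differentiableAt
    (by norm_num)).hasFDerivAt

lemma fderiv_velocity {a : Plane} (ht : t ∈ Ioo 0 T) (ha : a ∈ initialDomain) (v : Plane) :
    fderiv ℝ (u t) (η t a) v = fderiv ℝ (fun q : ℝ × Plane ↦ u q.1 q.2) (t, η t a) (0, v) := by
  have h2 : HasFDerivAt (fun x : Plane ↦ (t, x)) (ContinuousLinearMap.inr ℝ ℝ Plane) (η t a) :=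
    (hasFDerivAt_const (𝕜 := ℝ) t (η t a)).prodMk (hasFDerivAt_id (𝕜 := ℝ) (η t a))
  have h3 : HasFDerivAt (u t) _ (η t a) := (hs.hasFDerivAt_velocity ht ha).comp (η t a) h2
  rw [h3.fderiv]
  rfl

lemma deriv_velocity {a : Plane} (ht : t ∈ Ioo 0 T) (ha : a ∈ initialDomain) :
    deriv (fun s ↦ u s (η t a)) t =
      fderiv ℝ (fun q : ℝ × Plane ↦ u q.1 q.2) (t, η t a) (1, 0) := by
  have h2 : HasDerivAt (fun s : ℝ ↦ (s, η t a)) ((1 : ℝ), (0 : Plane)) t :=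
    (hasDerivAt_id t).prodMk (hasDerivAt_const t (η t a))
  have h3 := HasFDerivAt.comp_hasDerivAt (l := fun q : ℝ × Plane ↦ u q.1 q.2) t
    (hs.hasFDerivAt_velocity ht ha) h2
  exact h3.deriv

/-- The chain rule along the moving labels: the time component is kept, and the spatial component is
the derivative of the motion. -/
lemma fderivWithin_labelVelocity {a : Plane} (ht : t ∈ Ioo 0 T) (ha : a ∈ initialDomain)
    (v : ℝ × Plane) :
    fderivWithin ℝ (labelVelocity u η) (label T) (t, a) v =
      fderiv ℝ (fun q : ℝ × Plane ↦ u q.1 q.2) (t, η t a) (v.1, motionDeriv T η v (t, a)) := by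
  have hn := label_mem_nhds ht ha
  have hη : HasFDerivAt (fun q : ℝ × Plane ↦ η q.1 q.2)
      (fderivWithin ℝ (fun q : ℝ × Plane ↦ η q.1 q.2) (label T) (t, a)) (t, a) :=
    ((hs.motion.differentiableOn (t, a) (mem_of_mem_nhds hn)).hasFDerivWithinAt).hasFDerivAt hn
  have hZ : HasFDerivAt (fun q : ℝ × Plane ↦ (q.1, η q.1 q.2)) _ (t, a) :=
    hasFDerivAt_fst.prodMk hη
  have h3 := HasFDerivAt.comp (g := fun q : ℝ × Plane ↦ u q.1 q.2) (t, a)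
    (hs.hasFDerivAt_velocity ht ha) hZ
  have h4 : HasFDerivAt (labelVelocity u η) _ (t, a) := h3
  rw [fderivWithin_of_mem_nhds hn, h4.fderiv]
  rfl

lemma fderivWithin_labelVelocity_space {a : Plane} (ht : t ∈ Ioo 0 T) (ha : a ∈ initialDomain)
    (v : Plane) :
    fderivWithin ℝ (labelVelocity u η) (label T) (t, a) (0, v) =
      fderiv ℝ (u t) (η t a) (motionDeriv T η (0, v) (t, a)) := by
  rw [hs.fderivWithin_labelVelocity ht ha, hs.fderiv_velocity ht ha]

/-- The labels need not follow the particles, so the momentum equation leaves a transport term along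
the relative velocity ∂ₜη − u. -/
lemma fderivWithin_labelVelocity_time {a : Plane} (ht : t ∈ Ioo 0 T) (ha : a ∈ initialDomain) :
    fderivWithin ℝ (labelVelocity u η) (label T) (t, a) (1, 0) =
      fderiv ℝ (u t) (η t a) (motionDeriv T η (1, 0) (t, a) - labelVelocity u η (t, a)) -
        gradient (p t) (η t a) := by
  have hmom := hs.momentum t ht (η t a) (mem_image_of_mem _ ha)
  rw [hs.deriv_velocity ht ha] at hmom
  have hsplit : ((1 : ℝ), motionDeriv T η (1, 0) (t, a)) =
      (1, 0) + (0, motionDeriv T η (1, 0) (t, a)) := by simp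
  rw [hs.fderivWithin_labelVelocity ht ha, hsplit, map_add, ← hs.fderiv_velocity ht ha, map_sub]
  have h := eq_neg_of_add_eq_zero_left hmom
  change _ = _ - fderiv ℝ (u t) (η t a) (u t (η t a)) - _
  rw [eq_sub_of_add_eq h]
  abel

lemma hasFDerivAt_pressure {a : Plane} (ht : t ∈ Ioo 0 T) (ha : a ∈ initialDomain) :
    HasFDerivAt (fun a ↦ p t (η t a))
      ((innerSL ℝ (gradient (p t) (η t a))).comp
        ((fderivWithin ℝ (fun q : ℝ × Plane ↦ η q.1 q.2) (label T) (t, a)).comp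
          (ContinuousLinearMap.inr ℝ ℝ Plane))) a := by
  have ht' := Ioo_subset_Ico_self ht
  have hmem : closedFluidDomain η t ∈ 𝓝 (η t a) :=
    mem_of_superset ((hs.motion.isOpen_fluidDomain ht').mem_nhds (mem_image_of_mem _ ha))
      fluidDomain_subset
  have h1 : HasGradientAt (p t) (gradient (p t) (η t a)) (η t a) :=
    (((hs.pressure_contDiffOn t ht).contDiffAt hmem).differentiableAt (by norm_num)).hasGradientAt
  have h2 := hasFDerivAt_space hs.motion.differentiableOn ht' ha
  exact HasFDerivAt.comp a h1.hasFDerivAt h2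

lemma divergence_eq_zero {a : Plane} (ht : t ∈ Ico 0 T) (ha : a ∈ initialDomain) :
    fderiv ℝ (u t) (η t a) e₁ 0 + fderiv ℝ (u t) (η t a) e₂ 1 = 0 :=
  hs.incompressible t ht _ (mem_image_of_mem _ ha)

lemma fderivWithin_labelEnergy {q : ℝ × Plane} (hq : q ∈ label T) (v : ℝ × Plane) :
    fderivWithin ℝ (labelEnergy T u η) (label T) q v =
      fderivWithin ℝ (jac T η) (label T) q v *
        (1 / 2 * (labelVelocity u η q 0 ^ 2 + labelVelocity u η q 1 ^ 2)) +
      jac T η q * (labelVelocity u η q 0 * fderivWithin ℝ (labelVelocity u η) (label T) q v 0 +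
        labelVelocity u η q 1 * fderivWithin ℝ (labelVelocity u η) (label T) q v 1) := by
  have hw : ∀ i : Fin 2, HasFDerivWithinAt (fun q ↦ labelVelocity u η q i) _ (label T) q :=
    fun i ↦ hasFDerivWithinAt_coord ((hs.contDiffOn_labelVelocity.differentiableOn
      (by norm_num)) q hq).hasFDerivWithinAt i
  have hJ := ((hs.motion.contDiffOn_jac.differentiableOn (by norm_num)) q hq).hasFDerivWithinAt
  have hE : HasFDerivWithinAt (labelEnergy T u η) _ (label T) q :=
    hJ.mul ((((hw 0).pow 2).add ((hw 1).pow 2)).const_mul (1 / 2))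
  rw [hE.fderivWithin (uniqueDiffOn_label T q hq)]
  simp only [add_apply, smul_apply,
    ContinuousLinearMap.comp_apply, coordL_apply, smul_eq_mul]
  simp
  ring

end IsSolution

/-! ### Conservation of volume and energy -/

lemma continuousOn_fderivWithin_label {T : ℝ} {f : ℝ × Plane → ℝ} (hf : ContDiffOn ℝ 1 f (label T))
    (v : ℝ × Plane) : ContinuousOn (fun q ↦ fderivWithin ℝ f (label T) q v) (label T) :=
  (hf.continuousOn_fderivWithin (uniqueDiffOn_label T) (by norm_num)).clm_apply continuousOn_const

lemma continuousOn_label_slice {F : Type*} [TopologicalSpace F] {T t : ℝ} {f : ℝ × Plane → F}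
    (hf : ContinuousOn f (label T)) (ht : t ∈ Ico 0 T) :
    ContinuousOn (fun a ↦ f (t, a)) (closedStrip 2) :=
  hf.comp (f := fun a ↦ (t, a)) (by fun_prop) fun _ ha ↦ ⟨ht, ha⟩

/-- The increment in time of an integral over the labels. -/
lemma setIntegral_label_sub {T t : ℝ} {f : ℝ × Plane → ℝ} (hf : ContDiffOn ℝ 1 f (label T))
    (ht : t ∈ Ico 0 T) :
    (∫ a in box 2, f (t, a)) - ∫ a in box 2, f (0, a) =
      ∫ s in (0 : ℝ)..t, ∫ a in box 2, fderivWithin ℝ f (label T) (s, a) (1, 0) := by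
  have hsub : Icc 0 t ×ˢ box 2 ⊆ label T := prod_mono (Icc_subset_Ico_right ht.2) (box_subset 2)
  refine setIntegral_sub_eq_integral_deriv volume (isCompact_box 2) ht.1 (g := fun s a ↦ f (s, a))
    (g' := fun s a ↦ fderivWithin ℝ f (label T) (s, a) (1, 0)) (hf.continuousOn.mono hsub)
    ((continuousOn_fderivWithin_label hf _).mono hsub) fun s hs a ha ↦ ?_
  exact hasDerivAt_time (hf.differentiableOn (by norm_num)) ⟨hs.1, hs.2.trans ht.2⟩ (box_subset 2 ha)

namespace IsMotion

variable {T t : ℝ} {η : ℝ → Plane → Plane} (hη : IsMotion T η)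

include hη

lemma hasDerivAt_freeBoundary (ht : t ∈ Ico 0 T) (α : ℝ) :
    HasDerivAt (freeBoundary η t) (motionDeriv T η (0, e₁) (t, !₂[α, 2])) α :=
  hasDerivAt_horizontal hη.differentiableOn ht (by norm_num) α

lemma deriv_freeBoundary (ht : t ∈ Ico 0 T) (α : ℝ) :
    deriv (freeBoundary η t) α = motionDeriv T η (0, e₁) (t, !₂[α, 2]) :=
  (hη.hasDerivAt_freeBoundary ht α).deriv

lemma deriv_freeBoundary_time (ht : t ∈ Ioo 0 T) (α : ℝ) :
    deriv (fun s ↦ freeBoundary η s α) t = motionDeriv T η (1, 0) (t, !₂[α, 2]) :=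
  (hasDerivAt_time hη.differentiableOn ht (horizontal_mem (by norm_num) α)).deriv

lemma tangent_ne_zero {a : Plane} (ht : t ∈ Ico 0 T) (ha : a ∈ closedStrip 2) :
    motionDeriv T η (0, e₁) (t, a) ≠ 0 := by
  intro h
  have := hη.jac_pos ht ha
  simp [jac, h] at this

end IsMotion

namespace IsSolution

variable {σ T t : ℝ} {u : ℝ → Plane → Plane} {p : ℝ → Plane → ℝ} {η : ℝ → Plane → Plane}
  (hs : IsSolution σ T u p η)

include hs

/-- The kinematic condition with the length of the tangent cleared from the normal, in the form in
which fluxes occur in `IsMotion.integral_piola`. -/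
lemma kinematic_label (ht : t ∈ Ioo 0 T) (α : ℝ) :
    motionDeriv T η (0, e₁) (t, !₂[α, 2]) 0 * motionDeriv T η (1, 0) (t, !₂[α, 2]) 1 -
      motionDeriv T η (0, e₁) (t, !₂[α, 2]) 1 * motionDeriv T η (1, 0) (t, !₂[α, 2]) 0 =
    motionDeriv T η (0, e₁) (t, !₂[α, 2]) 0 * labelVelocity u η (t, !₂[α, 2]) 1 -
      motionDeriv T η (0, e₁) (t, !₂[α, 2]) 1 * labelVelocity u η (t, !₂[α, 2]) 0 := by
  have h := hs.kinematic t ht α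
  have ht' := Ioo_subset_Ico_self ht
  have hne := norm_ne_zero_iff.2
    (hs.motion.tangent_ne_zero ht' (horizontal_mem (y := 2) (by norm_num) α))
  rw [unitNormal, hs.motion.deriv_freeBoundary ht', hs.motion.deriv_freeBoundary_time ht,
    inner_smul_right, inner_smul_right] at h
  have h2 := mul_left_cancel₀ (inv_ne_zero hne) h
  simp only [inner_plane] at h2
  simp only [Matrix.cons_val_zero, Matrix.cons_val_one] at h2
  change _ = labelVelocity u η (t, !₂[α, 2]) 0 * _ + labelVelocity u η (t, !₂[α, 2]) 1 * _ at h2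
  linear_combination h2

lemma bottom_velocity (ht : t ∈ Ico 0 T) (α : ℝ) : labelVelocity u η (t, !₂[α, 0]) 1 = 0 :=
  hs.no_flow t ht _ (hs.motion.bottom t ht _ (horizontal_mem (by norm_num) α) (by simp))

lemma continuousOn_labelVelocity_slice (ht : t ∈ Ico 0 T) :
    ContinuousOn (fun a ↦ labelVelocity u η (t, a)) (closedStrip 2) :=
  continuousOn_label_slice hs.contDiffOn_labelVelocity.continuousOn ht

lemma continuousOn_motionDeriv_slice (ht : t ∈ Ico 0 T) (v : ℝ × Plane) :
    ContinuousOn (fun a ↦ motionDeriv T η v (t, a)) (closedStrip 2) :=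
  continuousOn_label_slice (hs.motion.contDiffOn_motionDeriv v).continuousOn ht

lemma continuousOn_labelPressure (ht : t ∈ Ioo 0 T) :
    ContinuousOn (fun a ↦ p t (η t a)) (closedStrip 2) :=
  (hs.pressure_contDiffOn t ht).continuousOn.comp
    (hs.motion.contDiffOn_slice (Ioo_subset_Ico_self ht)).continuousOn
    fun _ ha ↦ mem_image_of_mem _ ha

/-- The time derivative of the Jacobian is the divergence of the Piola transform of ∂ₜη. Subtracting
u costs nothing in the interior, because u is divergence free, and makes the flux vanish: on top by
the kinematic condition, on the bottom because both fields are tangential. -/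
lemma integral_deriv_jac (ht : t ∈ Ioo 0 T) :
    ∫ a in box 2, fderivWithin ℝ (jac T η) (label T) (t, a) (1, 0) = 0 := by
  have ht' := Ioo_subset_Ico_self ht
  have hV := fun a (ha : a ∈ initialDomain) ↦ hasFDerivAt_space
    ((hs.motion.contDiffOn_motionDeriv (1, 0)).differentiableOn (by norm_num)) ht' ha
  have hw := fun a (ha : a ∈ initialDomain) ↦ hasFDerivAt_space
    (hs.contDiffOn_labelVelocity.differentiableOn (by norm_num)) ht' ha
  rw [hs.motion.integral_piola ht'
    (G := fun a ↦ motionDeriv T η (1, 0) (t, a) - labelVelocity u η (t, a))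
    ((hs.continuousOn_motionDeriv_slice ht' _).sub (hs.continuousOn_labelVelocity_slice ht'))
    (fun a ha ↦ by
      simp only [hs.motion.motionDeriv_periodic _ ht' ha, hs.labelVelocity_periodic ht' ha])
    (fun a ha ↦ (hV a ha).sub (hw a ha))
    (continuousOn_label_slice (continuousOn_fderivWithin_label hs.motion.contDiffOn_jac _) ht')]
  · have h0 : ∀ α : ℝ,
        ((motionDeriv T η (0, e₁) (t, !₂[α, 2]) 0 *
            (motionDeriv T η (1, 0) (t, !₂[α, 2]) - labelVelocity u η (t, !₂[α, 2])) 1 -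
          motionDeriv T η (0, e₁) (t, !₂[α, 2]) 1 *
            (motionDeriv T η (1, 0) (t, !₂[α, 2]) - labelVelocity u η (t, !₂[α, 2])) 0) -
         (motionDeriv T η (0, e₁) (t, !₂[α, 0]) 0 *
            (motionDeriv T η (1, 0) (t, !₂[α, 0]) - labelVelocity u η (t, !₂[α, 0])) 1 -
          motionDeriv T η (0, e₁) (t, !₂[α, 0]) 1 *
            (motionDeriv T η (1, 0) (t, !₂[α, 0]) - labelVelocity u η (t, !₂[α, 0])) 0)) = 0 := by
      intro α
      simp only [PiLp.sub_apply, hs.motion.bottom_tangential ht', hs.motion.bottom_time ht,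
        hs.bottom_velocity ht']
      linear_combination hs.kinematic_label ht α
    simp only [h0, intervalIntegral.integral_zero]
  · intro a ha
    have htr := hs.divergence_eq_zero ht' ha
    rw [hs.motion.fderivWithin_jac ⟨ht', initialDomain_subset ha⟩]
    simp only [sub_apply, ContinuousLinearMap.comp_apply, ContinuousLinearMap.inr_apply,
      PiLp.sub_apply, hs.fderivWithin_labelVelocity_space ht ha]
    rw [clm_apply_eq (fderiv ℝ (u t) (η t a)) (motionDeriv T η (0, e₁) (t, a)),
      clm_apply_eq (fderiv ℝ (u t) (η t a)) (motionDeriv T η (0, e₂) (t, a))]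
    simp only [PiLp.add_apply, PiLp.smul_apply, smul_eq_mul]
    generalize fderiv ℝ (u t) (η t a) e₁ = m1 at *
    generalize fderiv ℝ (u t) (η t a) e₂ = m2 at *
    -- What remains is the Jacobian times the divergence of u.
    linear_combination (motionDeriv T η (0, e₁) (t, a) 0 * motionDeriv T η (0, e₂) (t, a) 1 -
      motionDeriv T η (0, e₂) (t, a) 0 * motionDeriv T η (0, e₁) (t, a) 1) * htr

lemma integral_jac (ht : t ∈ Ico 0 T) : ∫ a in box 2, jac T η (t, a) = 4 := by
  have h := setIntegral_label_sub hs.motion.contDiffOn_jac ht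
  have h0 : ∫ s in (0 : ℝ)..t, ∫ a in box 2, fderivWithin ℝ (jac T η) (label T) (s, a) (1, 0) =
      0 := by
    -- The integrand is known to vanish only at interior times; the endpoints are null.
    rw [intervalIntegral.integral_of_le ht.1, integral_Ioc_eq_integral_Ioo,
      setIntegral_congr_fun (g := fun _ ↦ (0 : ℝ)) measurableSet_Ioo fun s hs' ↦
        hs.integral_deriv_jac ⟨hs'.1, hs'.2.trans ht.2⟩]
    simp
  have h1 : ∫ a in box 2, jac T η (0, a) = 4 := by
    rw [setIntegral_congr_fun (g := fun _ ↦ (1 : ℝ)) (measurableSet_box 2) fun a ha ↦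
      hs.motion.jac_zero (ht.1.trans_lt ht.2) (box_subset 2 ha), setIntegral_box_eq,
      Measure.volume_eq_prod, setIntegral_const]
    simp only [Measure.real, Measure.prod_prod, Real.volume_Icc]
    rw [← ENNReal.ofReal_mul (by norm_num)]
    norm_num
  linarith

/-- The Euler equations write the rate of change of the energy density as the divergence of
½|u|²(∂ₜη − u) − p u, pulled back to the labels. The first term has no flux through the boundary, so
only the work of the pressure on the free boundary survives; there the kinematic condition replaces
u by ∂ₜη. -/
lemma integral_deriv_labelEnergy (ht : t ∈ Ioo 0 T) :
    ∫ a in box 2, fderivWithin ℝ (labelEnergy T u η) (label T) (t, a) (1, 0) =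
      ∫ α in (-1 : ℝ)..1, -(p t (freeBoundary η t α) *
        (motionDeriv T η (0, e₁) (t, !₂[α, 2]) 0 * motionDeriv T η (1, 0) (t, !₂[α, 2]) 1 -
          motionDeriv T η (0, e₁) (t, !₂[α, 2]) 1 * motionDeriv T η (1, 0) (t, !₂[α, 2]) 0)) := by
  have ht' := Ioo_subset_Ico_self ht
  have hV := fun a (ha : a ∈ initialDomain) ↦ hasFDerivAt_space
    ((hs.motion.contDiffOn_motionDeriv (1, 0)).differentiableOn (by norm_num)) ht' ha
  have hw := fun a (ha : a ∈ initialDomain) ↦ hasFDerivAt_space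
    (hs.contDiffOn_labelVelocity.differentiableOn (by norm_num)) ht' ha
  have hwc := fun i : Fin 2 ↦
    (continuous_coord i).comp_continuousOn (hs.continuousOn_labelVelocity_slice ht')
  have hk := fun a (ha : a ∈ initialDomain) ↦
    (((hasFDerivAt_coord (hw a ha) 0).pow 2).add ((hasFDerivAt_coord (hw a ha) 1).pow 2)).const_mul
      (1 / 2 : ℝ)
  have hkc : ContinuousOn (fun a ↦ 1 / 2 * (labelVelocity u η (t, a) 0 ^ 2 +
      labelVelocity u η (t, a) 1 ^ 2)) (closedStrip 2) :=
    continuousOn_const.mul (((hwc 0).pow 2).add ((hwc 1).pow 2))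
  rw [hs.motion.integral_piola ht'
    (G := fun a ↦ (1 / 2 * (labelVelocity u η (t, a) 0 ^ 2 + labelVelocity u η (t, a) 1 ^ 2)) •
      (motionDeriv T η (1, 0) (t, a) - labelVelocity u η (t, a)) -
        p t (η t a) • labelVelocity u η (t, a))
    ((hkc.smul ((hs.continuousOn_motionDeriv_slice ht' _).sub
      (hs.continuousOn_labelVelocity_slice ht'))).sub
      ((hs.continuousOn_labelPressure ht).smul (hs.continuousOn_labelVelocity_slice ht')))
    (fun a ha ↦ by
      simp only [hs.motion.motionDeriv_periodic _ ht' ha, hs.labelVelocity_periodic ht' ha,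
        hs.motion.equivariant t ht' a ha, hs.pressure_periodic t ht _])
    (fun a ha ↦ ((hk a ha).smul ((hV a ha).sub (hw a ha))).sub
      ((hs.hasFDerivAt_pressure ht ha).smul (hw a ha)))
    (continuousOn_label_slice (continuousOn_fderivWithin_label hs.contDiffOn_labelEnergy _) ht')]
  · refine intervalIntegral.integral_congr fun α _ ↦ ?_
    simp only [PiLp.sub_apply, PiLp.smul_apply, smul_eq_mul, hs.motion.bottom_tangential ht',
      hs.motion.bottom_time ht, hs.bottom_velocity ht', freeBoundary]
    linear_combination (1 / 2 * (labelVelocity u η (t, !₂[α, 2]) 0 ^ 2 +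
      labelVelocity u η (t, !₂[α, 2]) 1 ^ 2) + p t (η t !₂[α, 2])) * hs.kinematic_label ht α
  · intro a ha
    have hq : (t, a) ∈ label T := ⟨ht', initialDomain_subset ha⟩
    have htr := hs.divergence_eq_zero ht' ha
    rw [hs.fderivWithin_labelEnergy hq, hs.motion.fderivWithin_jac hq,
      hs.fderivWithin_labelVelocity_time ht ha]
    simp only [Pi.add_apply, Pi.sub_apply, sub_apply, add_apply, smul_apply,
      ContinuousLinearMap.comp_apply, ContinuousLinearMap.smulRight_apply, ContinuousLinearMap.inr_apply, coordL_apply,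
      PiLp.sub_apply, PiLp.add_apply, PiLp.smul_apply, smul_eq_mul, innerSL_apply_apply,
      inner_plane, hs.fderivWithin_labelVelocity_space ht ha]
    simp only [← motionDeriv.eq_1]
    rw [clm_apply_eq (fderiv ℝ (u t) (η t a)) (motionDeriv T η (0, e₁) (t, a)),
      clm_apply_eq (fderiv ℝ (u t) (η t a)) (motionDeriv T η (0, e₂) (t, a)),
      clm_apply_eq (fderiv ℝ (u t) (η t a)) (_ - _)]
    simp only [PiLp.sub_apply, PiLp.add_apply, PiLp.smul_apply, smul_eq_mul, jac]
    generalize fderiv ℝ (u t) (η t a) e₁ = m1 at *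
    generalize fderiv ℝ (u t) (η t a) e₂ = m2 at *
    generalize labelVelocity u η (t, a) = w at *
    -- The two sides differ by ½|u|² + p times the Jacobian times div u.
    linear_combination (1 / 2 * (w 0 ^ 2 + w 1 ^ 2) + p t (η t a)) *
      (motionDeriv T η (0, e₁) (t, a) 0 * motionDeriv T η (0, e₂) (t, a) 1 -
        motionDeriv T η (0, e₂) (t, a) 0 * motionDeriv T η (0, e₁) (t, a) 1) * htr

end IsSolution

/-! ### Surface energy -/

lemma hasDerivAt_norm_plane {f : ℝ → Plane} {f' : Plane} {x : ℝ} (hf : HasDerivAt f f' x)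
    (h : f x ≠ 0) : HasDerivAt (fun y ↦ ‖f y‖) (inner ℝ (f x) f' / ‖f x‖) x := by
  have hn : ‖f x‖ ≠ 0 := norm_ne_zero_iff.2 h
  have h1 := hf.norm_sq.sqrt (pow_ne_zero 2 hn)
  simp only [Real.sqrt_sq (norm_nonneg _)] at h1
  convert h1 using 1
  field_simp

/-- Differentiating the factor 1/|τ| in the normal contributes a multiple of the normal, which is
orthogonal to τ; only the rotated derivative of τ counts. -/
lemma meanCurvature_eq {γ τ : ℝ → Plane} {τ' : Plane} {α : ℝ} (hγ : ∀ β, HasDerivAt γ (τ β) β)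
    (hτ : HasDerivAt τ τ' α) (h : τ α ≠ 0) :
    meanCurvature γ α = (τ' 0 * τ α 1 - τ' 1 * τ α 0) / ‖τ α‖ ^ 3 := by
  have hn : ‖τ α‖ ≠ 0 := norm_ne_zero_iff.2 h
  have hN : unitNormal γ = fun β ↦ ‖τ β‖⁻¹ • pt (-(τ β 1), τ β 0) := by
    ext1 β
    rw [unitNormal, (hγ β).deriv, pt_eq]
  have h1 : HasDerivAt (fun β ↦ pt (-(τ β 1), τ β 0)) (pt (-(τ' 1), τ' 0)) α :=
    pt.hasFDerivAt.comp_hasDerivAt α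
      ((hasDerivAt_coord hτ 1).neg.prodMk (hasDerivAt_coord hτ 0))
  have h2 := ((hasDerivAt_norm_plane hτ h).inv hn).smul h1
  have hN' : unitNormal γ = (fun β ↦ ‖τ β‖)⁻¹ • fun β ↦ pt (-(τ β 1), τ β 0) := hN
  rw [meanCurvature, hN', h2.deriv, (hγ α).deriv, inner_plane]
  simp only [PiLp.add_apply, PiLp.smul_apply, pt_apply_zero, pt_apply_one, smul_eq_mul]
  simp only [Pi.inv_apply]
  field_simp
  ring

/-- Turns the product of curvature and normal velocity, both cross products with the tangent, into
the inner products that come from differentiating the length. -/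
lemma lagrange_identity (a b c d : Plane) :
    (a 0 * b 1 - a 1 * b 0) * (c 0 * d 1 - c 1 * d 0) =
      inner ℝ a c * inner ℝ b d - inner ℝ a d * inner ℝ b c := by
  simp only [inner_plane]
  ring

/-- The length of the free boundary over one period. -/
def boundaryLength (T : ℝ) (η : ℝ → Plane → Plane) (t : ℝ) : ℝ :=
  ∫ α in Icc (-1 : ℝ) 1, ‖motionDeriv T η (0, e₁) (t, !₂[α, 2])‖

lemma continuous_horizontal (y : ℝ) : Continuous (fun α : ℝ ↦ (!₂[α, y] : Plane)) := by
  simp only [← pt_eq]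
  fun_prop

lemma continuous_trace {F : Type*} [TopologicalSpace F] {T t : ℝ} {f : ℝ × Plane → F}
    (hf : ContinuousOn f (label T)) (ht : t ∈ Ico 0 T) :
    Continuous (fun α : ℝ ↦ f (t, !₂[α, 2])) :=
  (continuousOn_label_slice hf ht).comp_continuous (continuous_horizontal 2)
    (horizontal_mem (by norm_num))

lemma continuousOn_trace {F : Type*} [TopologicalSpace F] {T t : ℝ} {f : ℝ × Plane → F}
    (hf : ContinuousOn f (label T)) (ht : t ∈ Ico 0 T) (R : Set ℝ) :
    ContinuousOn (fun q : ℝ × ℝ ↦ f (q.1, !₂[q.2, 2])) (Icc 0 t ×ˢ R) := by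
  have h1 : Continuous (fun q : ℝ × ℝ ↦ (q.1, (!₂[q.2, 2] : Plane))) :=
    continuous_fst.prodMk ((continuous_horizontal 2).comp continuous_snd)
  refine hf.comp h1.continuousOn fun q hq ↦ ?_
  exact ⟨Icc_subset_Ico_right ht.2 hq.1, horizontal_mem (by norm_num) _⟩

namespace IsMotion

variable {T t : ℝ} {η : ℝ → Plane → Plane} (hη : IsMotion T η)

include hη

lemma continuousOn_fderivWithin_motionDeriv (v w : ℝ × Plane) :
    ContinuousOn (fun q ↦ fderivWithin ℝ (motionDeriv T η v) (label T) q w) (label T) :=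
  ((hη.contDiffOn_motionDeriv v).continuousOn_fderivWithin (uniqueDiffOn_label T)
    (by norm_num)).clm_apply continuousOn_const

lemma hasDerivAt_trace (ht : t ∈ Ico 0 T) (v : ℝ × Plane) (α : ℝ) :
    HasDerivAt (fun α ↦ motionDeriv T η v (t, !₂[α, 2]))
      (fderivWithin ℝ (motionDeriv T η v) (label T) (t, !₂[α, 2]) (0, e₁)) α :=
  hasDerivAt_horizontal ((hη.contDiffOn_motionDeriv v).differentiableOn (by norm_num)) ht
    (by norm_num) α

lemma meanCurvature_freeBoundary (ht : t ∈ Ico 0 T) (α : ℝ) :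
    meanCurvature (freeBoundary η t) α =
      (fderivWithin ℝ (motionDeriv T η (0, e₁)) (label T) (t, !₂[α, 2]) (0, e₁) 0 *
          motionDeriv T η (0, e₁) (t, !₂[α, 2]) 1 -
        fderivWithin ℝ (motionDeriv T η (0, e₁)) (label T) (t, !₂[α, 2]) (0, e₁) 1 *
          motionDeriv T η (0, e₁) (t, !₂[α, 2]) 0) /
        ‖motionDeriv T η (0, e₁) (t, !₂[α, 2])‖ ^ 3 :=
  meanCurvature_eq (fun β ↦ hη.hasDerivAt_freeBoundary ht β) (hη.hasDerivAt_trace ht _ α)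
    (hη.tangent_ne_zero ht (horizontal_mem (by norm_num) α))

/-- The first variation of the length of the free boundary. -/
lemma integral_deriv_length (ht : t ∈ Ico 0 T) :
    ∫ α in Icc (-1 : ℝ) 1, inner ℝ (motionDeriv T η (0, e₁) (t, !₂[α, 2]))
        (fderivWithin ℝ (motionDeriv T η (0, e₁)) (label T) (t, !₂[α, 2]) (1, 0)) /
          ‖motionDeriv T η (0, e₁) (t, !₂[α, 2])‖ =
      ∫ α in (-1 : ℝ)..1, meanCurvature (freeBoundary η t) α *
        (motionDeriv T η (0, e₁) (t, !₂[α, 2]) 0 * motionDeriv T η (1, 0) (t, !₂[α, 2]) 1 -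
          motionDeriv T η (0, e₁) (t, !₂[α, 2]) 1 * motionDeriv T η (1, 0) (t, !₂[α, 2]) 0) := by
  rw [integral_Icc_eq_integral_Ioc, ← intervalIntegral.integral_of_le (by norm_num), ← sub_eq_zero]
  have hne : ∀ α : ℝ, motionDeriv T η (0, e₁) (t, !₂[α, 2]) ≠ 0 := fun α ↦
    hη.tangent_ne_zero ht (horizontal_mem (by norm_num) α)
  have hn : ∀ α : ℝ, ‖motionDeriv T η (0, e₁) (t, !₂[α, 2])‖ ≠ 0 := fun α ↦
    norm_ne_zero_iff.2 (hne α)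
  have hc := fun v ↦ continuous_trace (hη.contDiffOn_motionDeriv v).continuousOn ht
  have hc' := fun v w ↦ continuous_trace (hη.continuousOn_fderivWithin_motionDeriv v w) ht
  have hci := fun v (i : Fin 2) ↦ (continuous_coord i).comp (hc v)
  have hci' := fun v w (i : Fin 2) ↦ (continuous_coord i).comp (hc' v w)
  have hH : Continuous (meanCurvature (freeBoundary η t)) := by
    have : meanCurvature (freeBoundary η t) = _ := funext (hη.meanCurvature_freeBoundary ht)
    rw [this]
    exact (((hci' _ _ 0).mul (hci _ 1)).sub ((hci' _ _ 1).mul (hci _ 0))).div ((hc _).norm.pow 3)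
      fun α ↦ pow_ne_zero 3 (hn α)
  have c1 : Continuous fun α : ℝ ↦ inner ℝ (motionDeriv T η (0, e₁) (t, !₂[α, 2]))
        (fderivWithin ℝ (motionDeriv T η (0, e₁)) (label T) (t, !₂[α, 2]) (1, 0)) /
          ‖motionDeriv T η (0, e₁) (t, !₂[α, 2])‖ :=
    ((hc _).inner (hc' _ _)).div (hc _).norm hn
  have c2 : Continuous fun α : ℝ ↦ meanCurvature (freeBoundary η t) α *
        (motionDeriv T η (0, e₁) (t, !₂[α, 2]) 0 * motionDeriv T η (1, 0) (t, !₂[α, 2]) 1 -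
          motionDeriv T η (0, e₁) (t, !₂[α, 2]) 1 * motionDeriv T η (1, 0) (t, !₂[α, 2]) 0) :=
    hH.mul (((hci _ 0).mul (hci _ 1)).sub ((hci _ 1).mul (hci _ 0)))
  rw [← intervalIntegral.integral_sub (c1.intervalIntegrable _ _) (c2.intervalIntegrable _ _)]
  -- The two integrands differ by the α-derivative of the tangential component of ∂ₜη, which is
  -- periodic and so integrates to zero. This is the integration by parts of the first variation
  -- formula.
  have hd : ∀ α : ℝ, HasDerivAt (fun α ↦ inner ℝ (motionDeriv T η (0, e₁) (t, !₂[α, 2]))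
      (motionDeriv T η (1, 0) (t, !₂[α, 2])) / ‖motionDeriv T η (0, e₁) (t, !₂[α, 2])‖)
      (inner ℝ (motionDeriv T η (0, e₁) (t, !₂[α, 2]))
        (fderivWithin ℝ (motionDeriv T η (0, e₁)) (label T) (t, !₂[α, 2]) (1, 0)) /
          ‖motionDeriv T η (0, e₁) (t, !₂[α, 2])‖ - meanCurvature (freeBoundary η t) α *
        (motionDeriv T η (0, e₁) (t, !₂[α, 2]) 0 * motionDeriv T η (1, 0) (t, !₂[α, 2]) 1 -
          motionDeriv T η (0, e₁) (t, !₂[α, 2]) 1 * motionDeriv T η (1, 0) (t, !₂[α, 2]) 0)) α := by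
    intro α
    have hq : (t, (!₂[α, 2] : Plane)) ∈ label T := ⟨ht, horizontal_mem (by norm_num) α⟩
    have h1 := ((hη.hasDerivAt_trace ht (0, e₁) α).inner ℝ (hη.hasDerivAt_trace ht (1, 0) α)).div
      (hasDerivAt_norm_plane (hη.hasDerivAt_trace ht (0, e₁) α) (hne α)) (hn α)
    refine h1.congr_deriv ?_
    rw [hη.meanCurvature_freeBoundary ht, hη.motionDeriv_comm hq (0, e₁) (1, 0)]
    have hL := lagrange_identity (motionDeriv T η (0, e₁) (t, !₂[α, 2]))
      (fderivWithin ℝ (motionDeriv T η (0, e₁)) (label T) (t, !₂[α, 2]) (0, e₁))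
      (motionDeriv T η (0, e₁) (t, !₂[α, 2])) (motionDeriv T η (1, 0) (t, !₂[α, 2]))
    rw [real_inner_self_eq_norm_sq, real_inner_comm (motionDeriv T η (0, e₁) (t, !₂[α, 2]))
      (fderivWithin ℝ (motionDeriv T η (0, e₁)) (label T) (t, !₂[α, 2]) (0, e₁))] at hL
    have := hn α
    field_simp
    linear_combination -hL
  rw [intervalIntegral.integral_eq_sub_of_hasDerivAt (fun α _ ↦ hd α)
    ((c1.sub c2).intervalIntegrable _ _)]
  have h1 : (!₂[1, 2] : Plane) = !₂[-1, 2] + period := by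
    rw [add_period_eq]; norm_num
  rw [h1, hη.motionDeriv_periodic _ ht (horizontal_mem (by norm_num) _),
    hη.motionDeriv_periodic _ ht (horizontal_mem (by norm_num) _), sub_self]

lemma boundaryLength_sub (ht : t ∈ Ico 0 T) :
    boundaryLength T η t - boundaryLength T η 0 =
      ∫ s in (0 : ℝ)..t, ∫ α in Icc (-1 : ℝ) 1,
        inner ℝ (motionDeriv T η (0, e₁) (s, !₂[α, 2]))
          (fderivWithin ℝ (motionDeriv T η (0, e₁)) (label T) (s, !₂[α, 2]) (1, 0)) /
            ‖motionDeriv T η (0, e₁) (s, !₂[α, 2])‖ := by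
  have hne : ∀ s ∈ Icc 0 t, ∀ α : ℝ, motionDeriv T η (0, e₁) (s, !₂[α, 2]) ≠ 0 := fun s hs α ↦
    hη.tangent_ne_zero (Icc_subset_Ico_right ht.2 hs) (horizontal_mem (by norm_num) α)
  have hc := continuousOn_trace (hη.contDiffOn_motionDeriv (0, e₁)).continuousOn ht
    (Icc (-1 : ℝ) 1)
  have hc' := continuousOn_trace (hη.continuousOn_fderivWithin_motionDeriv (0, e₁) (1, 0)) ht
    (Icc (-1 : ℝ) 1)
  refine setIntegral_sub_eq_integral_deriv volume isCompact_Icc ht.1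
    (g := fun s α ↦ ‖motionDeriv T η (0, e₁) (s, !₂[α, 2])‖)
    (g' := fun s α ↦ inner ℝ (motionDeriv T η (0, e₁) (s, !₂[α, 2]))
          (fderivWithin ℝ (motionDeriv T η (0, e₁)) (label T) (s, !₂[α, 2]) (1, 0)) /
            ‖motionDeriv T η (0, e₁) (s, !₂[α, 2])‖) hc.norm
    ((hc.inner hc').div hc.norm fun q hq ↦ norm_ne_zero_iff.2 (hne q.1 hq.1 q.2)) ?_
  intro s hs α _
  refine hasDerivAt_norm_plane ?_ (hne s (Ioo_subset_Icc_self hs) α)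
  exact hasDerivAt_time ((hη.contDiffOn_motionDeriv (0, e₁)).differentiableOn (by norm_num))
    ⟨hs.1, hs.2.trans ht.2⟩ (horizontal_mem (by norm_num) α)

lemma boundaryLength_zero (hT : 0 < T) : boundaryLength T η 0 = 2 := by
  have h : ∀ α : ℝ, ‖motionDeriv T η (0, e₁) (0, !₂[α, 2])‖ = 1 := by
    intro α
    rw [hη.motionDeriv_zero hT (horizontal_mem (by norm_num) α)]
    simp [e₁, EuclideanSpace.norm_eq, Fin.sum_univ_two]
  simp only [boundaryLength, h]
  norm_num

end IsMotion

/-! ### Conservation of the total energy -/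

namespace IsSolution

variable {σ T t : ℝ} {u : ℝ → Plane → Plane} {p : ℝ → Plane → ℝ} {η : ℝ → Plane → Plane}
  (hs : IsSolution σ T u p η)

include hs

lemma kineticEnergy_eq (ht : t ∈ Ico 0 T) :
    kineticEnergy u η t = ∫ a in box 2, labelEnergy T u η (t, a) := by
  rw [kineticEnergy, hs.motion.setIntegral_fluidDomain_inter_cell ht (f := fun x ↦ ‖u t x‖ ^ 2)
    (fun x _ ↦ by simp only [hs.velocity_periodic t ht x]), ← integral_const_mul]
  refine integral_congr_ae (Eventually.of_forall fun a ↦ ?_)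
  simp only [labelEnergy, labelVelocity, norm_sq_plane]
  ring

/-- Conservation of the total energy. -/
theorem energy_conservation (ht : t ∈ Ico 0 T) :
    kineticEnergy u η t + σ * boundaryLength T η t = kineticEnergy u η 0 + σ * 2 := by
  have hT : 0 < T := ht.1.trans_lt ht.2
  have h1 := setIntegral_label_sub hs.contDiffOn_labelEnergy ht
  have h2 := hs.motion.boundaryLength_sub ht
  rw [hs.motion.boundaryLength_zero hT] at h2
  rw [hs.kineticEnergy_eq ht, hs.kineticEnergy_eq ⟨le_rfl, hT⟩]
  have h3 : ∫ s in (0 : ℝ)..t, ∫ a in box 2,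
        fderivWithin ℝ (labelEnergy T u η) (label T) (s, a) (1, 0) =
      ∫ s in (0 : ℝ)..t, -σ * ∫ α in Icc (-1 : ℝ) 1,
        inner ℝ (motionDeriv T η (0, e₁) (s, !₂[α, 2]))
          (fderivWithin ℝ (motionDeriv T η (0, e₁)) (label T) (s, !₂[α, 2]) (1, 0)) /
            ‖motionDeriv T η (0, e₁) (s, !₂[α, 2])‖ := by
    rw [intervalIntegral.integral_of_le ht.1, intervalIntegral.integral_of_le ht.1,
      integral_Ioc_eq_integral_Ioo, integral_Ioc_eq_integral_Ioo]
    refine setIntegral_congr_fun measurableSet_Ioo fun s hs' ↦ ?_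
    have hs'' : s ∈ Ioo 0 T := ⟨hs'.1, hs'.2.trans ht.2⟩
    rw [hs.integral_deriv_labelEnergy hs'',
      hs.motion.integral_deriv_length (Ioo_subset_Ico_self hs''),
      ← intervalIntegral.integral_const_mul]
    refine intervalIntegral.integral_congr fun α _ ↦ ?_
    -- With p = σH, the work of the pressure becomes −σ times the first variation of length.
    simp only [hs.dynamic s hs'' α]
    ring
  rw [h3, intervalIntegral.integral_const_mul, ← h2] at h1
  linear_combination h1

end IsSolution

/-! ### The free boundary stays above height one -/

lemma coord_add_le_sqrt_two_mul_norm (a : Plane) : a 0 + a 1 ≤ √2 * ‖a‖ := by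
  rw [EuclideanSpace.norm_eq, ← Real.sqrt_mul (by norm_num)]
  refine Real.le_sqrt_of_sq_le ?_
  simp only [Fin.sum_univ_two, Real.norm_eq_abs, sq_abs]
  nlinarith [sq_nonneg (a 0 - a 1)]

lemma coord_sub_le_sqrt_two_mul_norm (a : Plane) : a 0 - a 1 ≤ √2 * ‖a‖ := by
  rw [EuclideanSpace.norm_eq, ← Real.sqrt_mul (by norm_num)]
  refine Real.le_sqrt_of_sq_le ?_
  simp only [Fin.sum_univ_two, Real.norm_eq_abs, sq_abs]
  nlinarith [sq_nonneg (a 0 + a 1)]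

lemma measureReal_box {h : ℝ} (hh : 0 ≤ h) : volume.real (box h) = 2 * h := by
  rw [Measure.real, ← measurePreserving_pt.measure_preimage_emb measurableEmbedding_pt,
    pt_preimage_box, Measure.volume_eq_prod, Measure.prod_prod, Real.volume_Icc, Real.volume_Icc,
    ← ENNReal.ofReal_mul (by norm_num), ENNReal.toReal_ofReal (by nlinarith)]
  ring

namespace IsMotion

variable {T t : ℝ} {η : ℝ → Plane → Plane} (hη : IsMotion T η)

include hη

lemma freeBoundary_add_two (ht : t ∈ Ico 0 T) (α : ℝ) :
    freeBoundary η t (α + 2) = freeBoundary η t α + period := by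
  rw [freeBoundary, ← add_period_eq, hη.equivariant t ht _ (horizontal_mem (by norm_num) α)]
  rfl

lemma continuous_tangent (ht : t ∈ Ico 0 T) :
    Continuous fun α : ℝ ↦ motionDeriv T η (0, e₁) (t, !₂[α, 2]) :=
  continuous_trace (hη.contDiffOn_motionDeriv (0, e₁)).continuousOn ht

lemma boundaryLength_eq (ht : t ∈ Ico 0 T) (α : ℝ) :
    boundaryLength T η t = ∫ β in α..α + 2, ‖motionDeriv T η (0, e₁) (t, !₂[β, 2])‖ := by
  have hper : Function.Periodic (fun β : ℝ ↦ ‖motionDeriv T η (0, e₁) (t, !₂[β, 2])‖) 2 := by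
    intro β
    simp only [← add_period_eq,
      hη.motionDeriv_periodic _ ht (horizontal_mem (y := 2) (by norm_num) β)]
  rw [hper.intervalIntegral_add_eq α (-1), boundaryLength, integral_Icc_eq_integral_Ioc,
    ← intervalIntegral.integral_of_le (by norm_num)]
  norm_num

lemma integral_tangent (ht : t ∈ Ico 0 T) (i : Fin 2) (α β : ℝ) :
    ∫ r in α..β, motionDeriv T η (0, e₁) (t, !₂[r, 2]) i =
      freeBoundary η t β i - freeBoundary η t α i :=
  intervalIntegral.integral_eq_sub_of_hasDerivAt
    (fun r _ ↦ hasDerivAt_coord (hη.hasDerivAt_freeBoundary ht r) i)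
    (((continuous_coord i).comp (hη.continuous_tangent ht)).intervalIntegrable _ _)

/-- Project the tangent on the direction (1, 1) while going from α to β and on (1, −1) from β to the
end of the period. Each projection is at most √2 times the speed; together they collect the
horizontal advance 2 and the height difference twice. -/
lemma two_add_le_boundaryLength (ht : t ∈ Ico 0 T) {α β : ℝ} (h1 : α ≤ β) (h2 : β ≤ α + 2) :
    2 + 2 * (freeBoundary η t β 1 - freeBoundary η t α 1) ≤ √2 * boundaryLength T η t := by
  have hc := hη.continuous_tangent ht
  have hci := fun i : Fin 2 ↦ (continuous_coord i).comp hc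
  have hi : ∀ (i : Fin 2) (a b : ℝ), IntervalIntegrable
      (fun r ↦ motionDeriv T η (0, e₁) (t, !₂[r, 2]) i) volume a b :=
    fun i a b ↦ (hci i).intervalIntegrable a b
  have hn := fun a b ↦ hc.norm.intervalIntegrable (μ := volume) a b
  have e1 : ∫ r in α..β, (motionDeriv T η (0, e₁) (t, !₂[r, 2]) 0 +
      motionDeriv T η (0, e₁) (t, !₂[r, 2]) 1) ≤
      ∫ r in α..β, √2 * ‖motionDeriv T η (0, e₁) (t, !₂[r, 2])‖ :=
    intervalIntegral.integral_mono_on h1 ((hi 0 _ _).add (hi 1 _ _)) ((hn _ _).const_mul _)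
      fun r _ ↦ coord_add_le_sqrt_two_mul_norm _
  have e2 : ∫ r in β..α + 2, (motionDeriv T η (0, e₁) (t, !₂[r, 2]) 0 -
      motionDeriv T η (0, e₁) (t, !₂[r, 2]) 1) ≤
      ∫ r in β..α + 2, √2 * ‖motionDeriv T η (0, e₁) (t, !₂[r, 2])‖ :=
    intervalIntegral.integral_mono_on h2 ((hi 0 _ _).sub (hi 1 _ _)) ((hn _ _).const_mul _)
      fun r _ ↦ coord_sub_le_sqrt_two_mul_norm _
  rw [intervalIntegral.integral_add (hi 0 _ _) (hi 1 _ _), hη.integral_tangent ht,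
    hη.integral_tangent ht, intervalIntegral.integral_const_mul] at e1
  rw [intervalIntegral.integral_sub (hi 0 _ _) (hi 1 _ _), hη.integral_tangent ht,
    hη.integral_tangent ht, intervalIntegral.integral_const_mul,
    hη.freeBoundary_add_two ht] at e2
  rw [hη.boundaryLength_eq ht α, ← intervalIntegral.integral_add_adjacent_intervals (hn α β)
    (hn β (α + 2))]
  simp only [PiLp.add_apply, period_zero, period_one] at e2
  linarith

/-- The horizontal advance over one period is 2, and it cannot exceed the length. -/
lemma two_le_boundaryLength (ht : t ∈ Ico 0 T) : 2 ≤ boundaryLength T η t := by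
  have hc := hη.continuous_tangent ht
  have e1 : ∫ r in (0 : ℝ)..0 + 2, motionDeriv T η (0, e₁) (t, !₂[r, 2]) 0 ≤
      ∫ r in (0 : ℝ)..0 + 2, ‖motionDeriv T η (0, e₁) (t, !₂[r, 2])‖ :=
    intervalIntegral.integral_mono_on (by norm_num)
      (((continuous_coord 0).comp hc).intervalIntegrable _ _) (hc.norm.intervalIntegrable _ _)
      fun r _ ↦ (Real.le_norm_self _).trans (PiLp.norm_apply_le _ _)
  rw [← hη.boundaryLength_eq ht, hη.integral_tangent ht, hη.freeBoundary_add_two ht] at e1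
  simpa using e1

/-- The height has a maximum by periodicity. It is not attained on the bottom, which lies below
everything else, nor at an interior label, where a critical point of the height would make the
Jacobian vanish. -/
lemma exists_forall_le_freeBoundary (ht : t ∈ Ico 0 T) :
    ∃ α : ℝ, ∀ a ∈ closedStrip 2, η t a 1 ≤ freeBoundary η t α 1 := by
  have hc : ContinuousOn (fun a ↦ η t a 1) (box 2) :=
    (continuous_coord 1).comp_continuousOn
      ((hη.contDiffOn_slice ht).continuousOn.mono (box_subset 2))
  obtain ⟨b, hb, hmax⟩ := (isCompact_box 2).exists_isMaxOn
    ⟨0, by simp [box]⟩ hc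
  have hmax' : ∀ a ∈ closedStrip 2, η t a 1 ≤ η t b 1 := by
    intro a ha
    obtain ⟨n, hn⟩ := exists_add_zsmul_mem_box ha
    have := hmax hn
    simpa [hη.map_add_zsmul ht ha] using this
  have hb1 : b 1 = 2 := by
    by_contra hne
    have hlt : b 1 < 2 := lt_of_le_of_ne hb.2.2 hne
    rcases hb.2.1.eq_or_lt with h0 | h0
    · have h1 := hη.bottom t ht b (box_subset 2 hb) h0.symm
      have h2 := hη.above t ht !₂[0, 1] (by simp [closedStrip]) (by simp)
      have h3 := hmax' !₂[0, 1] (by simp [closedStrip])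
      linarith
    · have hD : b ∈ initialDomain := ⟨h0, hlt⟩
      have hloc : IsLocalMax (fun a ↦ η t a 1) b :=
        Filter.mem_of_superset (closedStrip_mem_nhds h0 hlt) hmax'
      have hd : HasFDerivAt (fun a ↦ η t a 1) _ b :=
        hasFDerivAt_coord (hasFDerivAt_space hη.differentiableOn ht hD) 1
      have hz := hloc.hasFDerivAt_eq_zero hd
      have hv : ∀ v, motionDeriv T η (0, v) (t, b) 1 = 0 := fun v ↦
        DFunLike.congr_fun hz v
      have := hη.jac_pos ht (box_subset 2 hb)
      simp [jac, hv] at this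
  refine ⟨b 0, fun a ha ↦ ?_⟩
  have : (!₂[b 0, 2] : Plane) = b := plane_ext (by simp) (by simp [hb1])
  rw [freeBoundary, this]
  exact hmax' a ha

lemma isBounded_closedFluidDomain_inter (ht : t ∈ Ico 0 T) :
    ∃ M, closedFluidDomain η t ∩ {x | x 0 ∈ Icc (-1 : ℝ) 1} ⊆ box M := by
  obtain ⟨α, hα⟩ := hη.exists_forall_le_freeBoundary ht
  refine ⟨freeBoundary η t α 1, ?_⟩
  rintro _ ⟨⟨a, ha, rfl⟩, hx⟩
  refine ⟨hx, ?_, hα a ha⟩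
  rcases ha.1.eq_or_lt with h0 | h0
  · exact (hη.bottom t ht a ha h0.symm).ge
  · exact (hη.above t ht a ha h0).le

lemma isCompact_closedFluidDomain_inter (ht : t ∈ Ico 0 T) :
    IsCompact (closedFluidDomain η t ∩ {x | x 0 ∈ Icc (-1 : ℝ) 1}) := by
  obtain ⟨M, hM⟩ := hη.isBounded_closedFluidDomain_inter ht
  refine (isCompact_box M).of_isClosed_subset ?_ hM
  exact (hη.isClosed_closedFluidDomain ht).inter (isClosed_Icc.preimage (continuous_coord 0))

/-- The fluid domain is open, and it is also relatively closed in the strip: its limit points are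
images of closed labels, and boundary labels go to height 0 or above 1. The strip is connected and
meets the fluid domain, so it lies inside. -/
lemma strip_subset_of_lt_freeBoundary (ht : t ∈ Ico 0 T) (h : ∀ α, 1 < freeBoundary η t α 1) :
    {x : Plane | 0 < x 1 ∧ x 1 ≤ 1} ⊆ fluidDomain η t := by
  have htop : ∀ a ∈ closedStrip 2, a 1 = 2 → 1 < η t a 1 := by
    intro a ha ha2
    have : (!₂[a 0, 2] : Plane) = a := plane_ext (by simp) (by simp [ha2])
    rw [← this]
    exact h (a 0)
  have hconv : Convex ℝ {x : Plane | 0 < x 1 ∧ x 1 ≤ 1} := by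
    have : {x : Plane | 0 < x 1 ∧ x 1 ≤ 1} =
        (EuclideanSpace.proj (1 : Fin 2) : Plane →L[ℝ] ℝ) ⁻¹' Ioc 0 1 := by
      ext x; simp
    rw [this]
    exact (convex_Ioc 0 1).linear_preimage
      (EuclideanSpace.proj (1 : Fin 2) : Plane →L[ℝ] ℝ).toLinearMap
  refine hconv.isPreconnected.subset_of_closure_inter_subset (hη.isOpen_fluidDomain ht) ?_ ?_
  · have hc : ContinuousOn (fun r : ℝ ↦ η t !₂[0, r] 1) (Icc 0 2) := by
      refine (continuous_coord 1).comp_continuousOn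
        ((hη.contDiffOn_slice ht).continuousOn.comp (f := fun r : ℝ ↦ (!₂[0, r] : Plane)) ?_ ?_)
      · simp only [← pt_eq]
        fun_prop
      · exact fun r hr ↦ horizontal_mem hr 0
    have h0 := hη.bottom t ht !₂[0, 0] (horizontal_mem (by norm_num) 0) (by simp)
    have h2 := h 0
    -- A vertical line of labels runs from height 0 to above 1; any height in between, here 1/2,
    -- yields a point of the strip in the fluid.
    obtain ⟨r, hr, hr'⟩ := intermediate_value_Icc (by norm_num) hc
      (show (1 / 2 : ℝ) ∈ Icc _ _ from ⟨by rw [h0]; norm_num, by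
        rw [freeBoundary] at h2
        linarith⟩)
    refine ⟨η t !₂[0, r], ⟨by simp only [hr']; norm_num, by simp only [hr']; norm_num⟩, ?_⟩
    refine mem_image_of_mem _ ⟨?_, ?_⟩
    · refine lt_of_le_of_ne (by simpa using hr.1) fun h' ↦ ?_
      have := hη.bottom t ht !₂[0, r] (horizontal_mem hr 0) h'.symm
      simp only [hr'] at this
      norm_num at this
    · refine lt_of_le_of_ne (by simpa using hr.2) fun h' ↦ ?_
      have := htop !₂[0, r] (horizontal_mem hr 0) h'
      simp only [hr'] at this
      norm_num at this
  · rintro x ⟨hx, hx0, hx1⟩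
    obtain ⟨a, ha, rfl⟩ := closure_minimal fluidDomain_subset (hη.isClosed_closedFluidDomain ht) hx
    refine mem_image_of_mem _ ⟨lt_of_le_of_ne ha.1 fun h' ↦ ?_, lt_of_le_of_ne ha.2 fun h' ↦ ?_⟩
    · exact hx0.ne' (hη.bottom t ht a ha h'.symm)
    · exact (htop a ha h').not_ge hx1

lemma Ω_subset_of_lt_freeBoundary (ht : t ∈ Ico 0 T) (h : ∀ α, 1 < freeBoundary η t α 1) :
    Ω ⊆ closedFluidDomain η t := by
  intro x hx
  have hsub := (hη.strip_subset_of_lt_freeBoundary ht h).trans fluidDomain_subset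
  rcases hx.1.eq_or_lt with h0 | h0
  · have hlim : Tendsto (fun r : ℝ ↦ x + r • e₂) (𝓝[>] 0) (𝓝 x) := by
      have : Tendsto (fun r : ℝ ↦ x + r • e₂) (𝓝 0) (𝓝 (x + (0 : ℝ) • e₂)) :=
        Continuous.tendsto (by fun_prop) 0
      rw [zero_smul, add_zero] at this
      exact this.mono_left nhdsWithin_le_nhds
    refine (hη.isClosed_closedFluidDomain ht).mem_of_tendsto hlim ?_
    filter_upwards [Ioo_mem_nhdsGT (zero_lt_one' ℝ)] with r hr
    exact hsub ⟨by simpa [← h0] using hr.1, by simpa [← h0] using hr.2.le⟩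
  · exact hsub ⟨h0, hx.2⟩

end IsMotion

namespace IsSolution

variable {σ T t : ℝ} {u : ℝ → Plane → Plane} {p : ℝ → Plane → ℝ} {η : ℝ → Plane → Plane}
  (hs : IsSolution σ T u p η)

include hs

/-- The fluid in one cell has area 4 and fits in a box of width 2 whose height is the highest point
of the free boundary. -/
lemma exists_two_le_freeBoundary (ht : t ∈ Ico 0 T) : ∃ α, 2 ≤ freeBoundary η t α 1 := by
  obtain ⟨α, hα⟩ := hs.motion.exists_forall_le_freeBoundary ht
  refine ⟨α, ?_⟩
  have h1 := hs.motion.setIntegral_fluidDomain_inter_cell ht (f := fun _ ↦ (1 : ℝ)) (by simp)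
  simp only [mul_one, hs.integral_jac ht, setIntegral_const, smul_eq_mul] at h1
  have hpos : 0 < freeBoundary η t α 1 := hs.motion.above t ht !₂[α, 2] (horizontal_mem (by norm_num) α) (by simp)
  have hsub : fluidDomain η t ∩ cell ⊆ box (freeBoundary η t α 1) := by
    rintro _ ⟨⟨a, ha, rfl⟩, hx⟩
    exact ⟨Ico_subset_Icc_self hx, (hs.motion.above t ht a (initialDomain_subset ha) ha.1).le,
      hα a (initialDomain_subset ha)⟩
  have h2 := measureReal_mono (μ := volume) hsub (isCompact_box _).measure_lt_top.ne
  rw [h1, measureReal_box hpos.le] at h2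
  linarith

/-- The length never falls below its initial value 2, so the surface energy cannot feed the kinetic
energy. -/
lemma kineticEnergy_le (hσ : 0 < σ) (ht : t ∈ Ico 0 T) :
    kineticEnergy u η t ≤ kineticEnergy u η 0 := by
  have h1 := hs.energy_conservation ht
  nlinarith [hs.motion.two_le_boundaryLength ht]

/-- Energy conservation gives length at most 2 + 1/20. A point at height at most 1 together with one
at height at least 2 would force √2 times the length to be at least 4, whereas 1.5 · 2.05 < 4. -/
lemma one_lt_freeBoundary (hσ : 0 < σ) (hK : kineticEnergy u η 0 ≤ σ / 20) (ht : t ∈ Ico 0 T)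
    (α : ℝ) : 1 < freeBoundary η t α 1 := by
  have h1 := hs.energy_conservation ht
  have h0 : 0 ≤ kineticEnergy u η t :=
    mul_nonneg (by norm_num) (integral_nonneg fun x ↦ sq_nonneg _)
  have hL : boundaryLength T η t ≤ 2 + 1 / 20 := by
    refine le_of_mul_le_mul_left ?_ hσ
    linarith
  by_contra! hα
  obtain ⟨β, hβ⟩ := hs.exists_two_le_freeBoundary ht
  have hper : Function.Periodic (fun β ↦ freeBoundary η t β 1) 2 := by
    intro β
    simp [hs.motion.freeBoundary_add_two ht]
  -- The high point is moved by a multiple of the period into the period that starts at the low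
  -- point.
  obtain ⟨β', hβ', hβ''⟩ := hper.exists_mem_Ico two_pos β α
  have h2 := hs.motion.two_add_le_boundaryLength ht hβ'.1 hβ'.2.le
  simp only at hβ''
  have h3 : √2 * boundaryLength T η t ≤ √2 * (2 + 1 / 20) := by gcongr
  have h4 : √2 < 1.5 := by
    rw [Real.sqrt_lt' (by norm_num)]
    norm_num
  nlinarith

theorem strip_subset_fluidDomain (hσ : 0 < σ) (hK : kineticEnergy u η 0 ≤ σ / 20)
    (ht : t ∈ Ico 0 T) : {x : Plane | 0 < x 1 ∧ x 1 ≤ 1} ⊆ fluidDomain η t :=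
  hs.motion.strip_subset_of_lt_freeBoundary ht (hs.one_lt_freeBoundary hσ hK ht)

theorem Ω_subset_closedFluidDomain (hσ : 0 < σ) (hK : kineticEnergy u η 0 ≤ σ / 20)
    (ht : t ∈ Ico 0 T) : Ω ⊆ closedFluidDomain η t :=
  hs.motion.Ω_subset_of_lt_freeBoundary ht (hs.one_lt_freeBoundary hσ hK ht)

/-- The kinetic energy controls the velocity in `Ω`. -/
theorem integral_norm_sq_velocity_le (hσ : 0 < σ) (hK : kineticEnergy u η 0 ≤ σ / 20)
    (ht : t ∈ Ico 0 T) : ∫ x in box 1, ‖u t x‖ ^ 2 ≤ 2 * kineticEnergy u η 0 := by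
  refine le_trans ?_ (mul_le_mul_of_nonneg_left (hs.kineticEnergy_le hσ ht) zero_le_two)
  rw [kineticEnergy, ← mul_assoc, ← setIntegral_congr_set (box_eq_inter_ae 1)]
  norm_num
  refine setIntegral_mono_set ?_ (ae_of_all _ fun x ↦ sq_nonneg _) ?_
  · have hcont : ContinuousOn (fun x ↦ ‖u t x‖ ^ 2) (closedFluidDomain η t) :=
      (hs.velocity_contDiffOn_space t ht).continuousOn.norm.pow 2
    refine ((hcont.mono inter_subset_left).integrableOn_compact
      (hs.motion.isCompact_closedFluidDomain_inter ht)).mono_set ?_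
    exact inter_subset_inter fluidDomain_subset fun x hx ↦ Ico_subset_Icc_self hx
  · refine (inter_subset_inter_left _ fun x hx ↦ ?_).eventuallyLE
    exact hs.strip_subset_fluidDomain hσ hK ht ⟨hx.1, hx.2.le⟩

end IsSolution

/-! ### Schwarz reflection -/

open Complex in
-- The hypothesis of Morera's theorem. A rectangle across the real axis is cut along it; each half
-- meets the axis only in an edge, where the Cauchy–Goursat theorem asks for continuity alone.
lemma isConservativeOn_of_differentiableAt_off_real {U : Set ℂ} {f : ℂ → ℂ} (hc : ContinuousOn f U)
    (hd : ∀ z ∈ U, z.im ≠ 0 → DifferentiableAt ℂ f z) : IsConservativeOn f U := by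
  have hzero : ∀ z w : ℂ, (uIcc z.re w.re) ×ℂ (uIcc z.im w.im) ⊆ U →
      (0 : ℝ) ∉ Ioo (min z.im w.im) (max z.im w.im) →
      wedgeIntegral z w f + wedgeIntegral w z f = 0 := by
    intro z w hzw h0
    rw [wedgeIntegral_add_wedgeIntegral_eq]
    refine integral_boundary_rect_eq_zero_of_continuousOn_of_differentiableOn f z w (hc.mono hzw)
      fun x hx ↦ ?_
    refine (hd x (hzw ⟨Ioo_subset_Icc_self hx.1, Ioo_subset_Icc_self hx.2⟩) fun h ↦ h0 ?_)
      |>.differentiableWithinAt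
    rw [← h]
    exact hx.2
  intro z w hzw
  replace hzw : (uIcc z.re w.re) ×ℂ (uIcc z.im w.im) ⊆ U := hzw
  rw [← add_eq_zero_iff_eq_neg]
  by_cases h0 : (0 : ℝ) ∈ Ioo (min z.im w.im) (max z.im w.im)
  · have h0' : (0 : ℝ) ∈ uIcc z.im w.im := Ioo_subset_Icc_self h0
    have h1 : uIcc z.im 0 ⊆ uIcc z.im w.im := uIcc_subset_uIcc left_mem_uIcc h0'
    have h2 : uIcc 0 w.im ⊆ uIcc z.im w.im := uIcc_subset_uIcc h0' right_mem_uIcc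
    have e1 := hzero z ⟨w.re, 0⟩ (fun x hx ↦ hzw ⟨hx.1, h1 hx.2⟩)
      (by
        rcases le_total z.im 0 with h | h <;> simp [h])
    have e2 := hzero ⟨z.re, 0⟩ w (fun x hx ↦ hzw ⟨hx.1, h2 hx.2⟩)
      (by
        rcases le_total w.im 0 with h | h <;> simp [h])
    rw [wedgeIntegral_add_wedgeIntegral_eq] at e1 e2 ⊢
    have hi : ∀ x ∈ uIcc z.re w.re, ∀ a b : ℝ, uIcc a b ⊆ uIcc z.im w.im →
        IntervalIntegrable (fun y : ℝ ↦ f (x + y * I)) volume a b := by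
      intro x hx a b hab
      refine ContinuousOn.intervalIntegrable ?_
      refine hc.comp (by fun_prop) fun y hy ↦ hzw ⟨?_, ?_⟩
      · simpa using hx
      · simpa using hab hy
    rw [← intervalIntegral.integral_add_adjacent_intervals (hi _ right_mem_uIcc _ _ h1)
      (hi _ right_mem_uIcc _ _ h2),
      ← intervalIntegral.integral_add_adjacent_intervals (hi _ left_mem_uIcc _ _ h1)
      (hi _ left_mem_uIcc _ _ h2)]
    simp only [smul_eq_mul] at e1 e2 ⊢
    linear_combination e1 + e2
  · exact hzero z w hzw h0

/-- The Schwarz reflection of a function on the upper half plane. -/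
def schwarzReflection (h : ℂ → ℂ) (z : ℂ) : ℂ :=
  if 0 ≤ z.im then h z else (starRingEnd ℂ) (h ((starRingEnd ℂ) z))

open ComplexConjugate in
lemma schwarzReflection_conj {h : ℂ → ℂ} {z : ℂ} (hz : z.im < 0) :
    schwarzReflection h z = conj (h (conj z)) := by
  rw [schwarzReflection, if_neg hz.not_ge]

lemma schwarzReflection_of_nonneg {h : ℂ → ℂ} {z : ℂ} (hz : 0 ≤ z.im) :
    schwarzReflection h z = h z := by
  rw [schwarzReflection, if_pos hz]

open ComplexConjugate in
/-- The Schwarz reflection principle. -/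
theorem differentiableOn_schwarzReflection {r : ℝ} {h : ℂ → ℂ}
    (hc : ContinuousOn h (Metric.ball 0 r ∩ {z | 0 ≤ z.im}))
    (hd : ∀ z ∈ Metric.ball (0 : ℂ) r, 0 < z.im → DifferentiableAt ℂ h z)
    (hreal : ∀ z ∈ Metric.ball (0 : ℂ) r, z.im = 0 → (h z).im = 0) :
    DifferentiableOn ℂ (schwarzReflection h) (Metric.ball 0 r) := by
  have hconj : ∀ z ∈ Metric.ball (0 : ℂ) r, conj z ∈ Metric.ball (0 : ℂ) r := by
    intro z hz
    simpa [mem_ball_zero_iff] using hz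
  rw [← Complex.isConservativeOn_and_continuousOn_iff_isDifferentiableOn Metric.isOpen_ball]
  have hcont : ContinuousOn (schwarzReflection h) (Metric.ball 0 r) := by
    have hlow : ContinuousOn (fun z ↦ conj (h (conj z))) (Metric.ball 0 r ∩ {z | z.im ≤ 0}) := by
      refine Complex.continuous_conj.comp_continuousOn
        (hc.comp Complex.continuous_conj.continuousOn fun z hz ↦ ⟨hconj z hz.1, ?_⟩)
      simpa using hz.2
    refine ContinuousOn.if (p := fun z : ℂ ↦ 0 ≤ z.im) ?_ ?_ ?_
    · rintro z ⟨hz, hz'⟩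
      rw [Complex.frontier_setOfPred_le_im] at hz'
      have h1 : z.im = 0 := hz'
      have h2 : conj z = z := Complex.conj_eq_iff_im.2 h1
      rw [h2]
      exact (Complex.conj_eq_iff_im.2 (hreal z hz h1)).symm
    · rw [(isClosed_le continuous_const Complex.continuous_im).closure_eq]
      exact hc
    · have : {z : ℂ | ¬ 0 ≤ z.im} = {z | z.im < 0} := by ext z; simp
      rw [this, Complex.closure_setOfPred_im_lt]
      exact hlow
  refine ⟨isConservativeOn_of_differentiableAt_off_real hcont fun z hz h0 ↦ ?_, hcont⟩
  rcases h0.lt_or_gt with h0 | h0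
  · have hev : schwarzReflection h =ᶠ[𝓝 z] fun z ↦ conj (h (conj z)) := by
      filter_upwards [(isOpen_lt Complex.continuous_im continuous_const).mem_nhds h0] with w hw
      exact schwarzReflection_conj hw
    refine DifferentiableAt.congr_of_eventuallyEq ?_ hev
    have := hd (conj z) (hconj z hz) (by simpa using h0)
    exact (differentiableAt_conj_conj_iff (f := h)).2 this
  · have hev : schwarzReflection h =ᶠ[𝓝 z] h := by
      filter_upwards [(isOpen_lt continuous_const Complex.continuous_im).mem_nhds h0] with w hw
      exact schwarzReflection_of_nonneg (le_of_lt hw)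
    exact (hd z hz h0).congr_of_eventuallyEq hev

/-! ### Interior estimates for holomorphic functions -/

/-- The mean value property over disks. -/
lemma integral_ball_of_diffContOnCl {g : ℂ → ℂ} {w : ℂ} {r : ℝ} (hr : 0 < r)
    (hg : DiffContOnCl ℂ g (Metric.ball w r)) :
    ∫ z in Metric.ball w r, g z = (Real.pi * r ^ 2 : ℝ) • g w := by
  have hgc : ContinuousOn g (Metric.closedBall w r) := by
    have := hg.continuousOn
    rwa [closure_ball w hr.ne'] at this
  have hshift : ∫ z in Metric.ball w r, g z =
      ∫ z, (Metric.ball (0 : ℂ) r).indicator (fun z ↦ g (w + z)) z := by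
    rw [integral_indicator measurableSet_ball]
    have := (measurePreserving_add_left volume w).setIntegral_preimage_emb
      (measurableEmbedding_addLeft w) g (Metric.ball w r)
    rw [← this]
    congr 2
    ext z
    simp
  have htarget : ∀ p ∈ Complex.polarCoord.target,
      p.1 • (Metric.ball (0 : ℂ) r).indicator (fun z ↦ g (w + z)) (Complex.polarCoord.symm p) =
      (Ioo 0 r ×ˢ Ioo (-Real.pi) Real.pi).indicator
        (fun p : ℝ × ℝ ↦ p.1 • g (circleMap w p.1 p.2)) p := by
    rintro ⟨ρ, θ⟩ ⟨hρ, hθ⟩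
    have hρ' : 0 < ρ := hρ
    by_cases hlt : ρ < r
    · have h1 : Complex.polarCoord.symm (ρ, θ) ∈ Metric.ball (0 : ℂ) r := by
        rw [mem_ball_zero_iff, Complex.norm_polarCoord_symm]
        simpa [abs_of_pos hρ'] using hlt
      rw [indicator_of_mem h1, indicator_of_mem (show (ρ, θ) ∈ Ioo 0 r ×ˢ Ioo (-Real.pi) Real.pi from
        ⟨⟨hρ', hlt⟩, hθ⟩)]
      simp only [Complex.polarCoord_symm_apply, circleMap, Complex.exp_mul_I, Complex.ofReal_cos,
        Complex.ofReal_sin]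
    · have h1 : Complex.polarCoord.symm (ρ, θ) ∉ Metric.ball (0 : ℂ) r := by
        rw [mem_ball_zero_iff, Complex.norm_polarCoord_symm]
        simpa [abs_of_pos hρ'] using hlt
      rw [indicator_of_notMem h1, indicator_of_notMem (fun h ↦ hlt h.1.2), smul_zero]
  have hmeas : MeasurableSet (Ioo 0 r ×ˢ Ioo (-Real.pi) Real.pi) :=
    measurableSet_Ioo.prod measurableSet_Ioo
  have hsub : Ioo 0 r ×ˢ Ioo (-Real.pi) Real.pi ⊆ Complex.polarCoord.target := by
    rw [Complex.polarCoord_target]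
    exact prod_mono_left Ioo_subset_Ioi_self
  have hcm : Continuous fun p : ℝ × ℝ ↦ circleMap w p.1 p.2 := by
    unfold circleMap
    fun_prop
  have hcont : ContinuousOn (fun p : ℝ × ℝ ↦ p.1 • g (circleMap w p.1 p.2))
      (Icc 0 r ×ˢ Icc (-Real.pi) Real.pi) := by
    refine continuousOn_fst.smul (hgc.comp hcm.continuousOn fun p hp ↦ ?_)
    rw [Metric.mem_closedBall, dist_eq_norm]
    simp only [circleMap, add_sub_cancel_left, norm_mul, Complex.norm_real,
      Complex.norm_exp_ofReal_mul_I, mul_one, Real.norm_eq_abs, abs_of_nonneg hp.1.1]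
    exact hp.1.2
  have hint : IntegrableOn (fun p : ℝ × ℝ ↦ p.1 • g (circleMap w p.1 p.2))
      (Ioo 0 r ×ˢ Ioo (-Real.pi) Real.pi) (volume.prod volume) :=
    (hcont.integrableOn_compact (isCompact_Icc.prod isCompact_Icc)).mono_set
      (prod_mono Ioo_subset_Icc_self Ioo_subset_Icc_self)
  have hcircle : ∀ ρ ∈ Ioo 0 r, ∫ θ in Ioo (-Real.pi) Real.pi, ρ • g (circleMap w ρ θ) =
      ρ • (2 * Real.pi) • g w := by
    intro ρ hρ
    rw [integral_smul]
    congr 1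
    have h1 : Real.circleAverage g w ρ = g w := by
      refine DiffContOnCl.circleAverage (hg.mono (Metric.ball_subset_ball ?_))
      rw [abs_of_pos hρ.1]
      exact hρ.2.le
    have hper : Function.Periodic (fun θ ↦ g (circleMap w ρ θ)) (2 * Real.pi) := by
      intro θ
      simp only [periodic_circleMap w ρ θ]
    have h2 := hper.intervalIntegral_add_eq (-Real.pi) 0
    rw [← integral_Ioc_eq_integral_Ioo, ← intervalIntegral.integral_of_le (by
      linarith [Real.pi_pos])]
    have h3 : -Real.pi + 2 * Real.pi = Real.pi := by ring
    rw [h3, zero_add] at h2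
    rw [h2, ← h1, Real.circleAverage_def, smul_smul, mul_inv_cancel₀ (by positivity), one_smul]
  -- In polar coordinates the disk integral is a radial integral of circle averages, each equal to
  -- g(w).
  rw [hshift, ← Complex.integral_comp_polarCoord_symm]
  rw [show (polarCoord.target : Set (ℝ × ℝ)) = Complex.polarCoord.target from rfl]
  rw [setIntegral_congr_fun Complex.polarCoord.open_target.measurableSet htarget,
    setIntegral_indicator hmeas, inter_eq_right.2 hsub, Measure.volume_eq_prod,
    setIntegral_prod _ hint, setIntegral_congr_fun measurableSet_Ioo hcircle,
    integral_smul_const, ← integral_Ioc_eq_integral_Ioo, ← intervalIntegral.integral_of_le hr.le,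
    integral_id, smul_smul]
  congr 1
  ring

/-- The interior gradient estimate of holomorphic functions. -/
theorem norm_deriv_le_of_integral_ball_le {f : ℂ → ℂ} {A : ℝ} (hA : 0 ≤ A)
    (hf : DifferentiableOn ℂ f (Metric.ball 0 1))
    (hint : ∀ w ∈ Metric.closedBall (0 : ℂ) (5 / 8), ∫ z in Metric.ball w (1 / 4), ‖f z‖ ^ 2 ≤ A)
    {z : ℂ} (hz : z ∈ Metric.ball (0 : ℂ) (1 / 2)) : ‖deriv f z‖ ≤ 24 * √A := by
  have hsub : ∀ w ∈ Metric.closedBall (0 : ℂ) (5 / 8),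
      Metric.closedBall w (1 / 4) ⊆ Metric.ball (0 : ℂ) 1 := by
    intro w hw
    refine Metric.closedBall_subset_ball' ?_
    rw [mem_closedBall_iff_norm, sub_zero] at hw
    rw [dist_zero_right]
    linarith
  have hpt : ∀ w ∈ Metric.closedBall (0 : ℂ) (5 / 8), ‖f w‖ ≤ 3 * √A := by
    intro w hw
    -- The mean value property is applied to f², which is holomorphic and whose modulus is the
    -- integrand of the hypothesis.
    have hd : DiffContOnCl ℂ (fun z ↦ f z ^ 2) (Metric.ball w (1 / 4)) :=
      ((hf.pow 2).mono (hsub w hw)).diffContOnCl_ball le_rfl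
    have h1 := integral_ball_of_diffContOnCl (by norm_num) hd
    have h2 : ‖∫ z in Metric.ball w (1 / 4), f z ^ 2‖ ≤ A := by
      refine (norm_integral_le_integral_norm _).trans ?_
      simpa only [norm_pow] using hint w hw
    rw [h1, norm_smul, norm_pow, Real.norm_eq_abs, abs_of_pos (by positivity)] at h2
    -- The disk has area π/16, so 16/π would do; 9 is a perfect square above it.
    have h3 : ‖f w‖ ^ 2 ≤ 9 * A := by
      have := Real.pi_gt_three
      nlinarith [sq_nonneg ‖f w‖]
    have h4 := Real.sqrt_le_sqrt h3
    rw [Real.sqrt_sq (norm_nonneg _), Real.sqrt_mul (by norm_num)] at h4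
    rwa [show (9 : ℝ) = 3 ^ 2 by norm_num, Real.sqrt_sq (by norm_num)] at h4
  have hz' : Metric.closedBall z (1 / 8) ⊆ Metric.closedBall (0 : ℂ) (5 / 8) := by
    refine Metric.closedBall_subset_closedBall' ?_
    rw [mem_ball_zero_iff] at hz
    rw [dist_zero_right]
    linarith
  -- Cauchy's estimate on radius 1/8 = 5/8 − 1/2 gives 3 · 8 = 24.
  have hd : DiffContOnCl ℂ f (Metric.ball z (1 / 8)) :=
    (hf.mono (hz'.trans (Metric.closedBall_subset_ball (by norm_num)))).diffContOnCl_ball le_rfl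
  have := Complex.norm_deriv_le_of_forall_mem_sphere_norm_le (by norm_num) hd
    fun w hw ↦ hpt w (hz' (Metric.sphere_subset_closedBall hw))
  refine this.trans (le_of_eq ?_)
  ring

/-! ### The stream function -/

lemma mem_frontier_Ω {x : Plane} (hx : x 1 = 0 ∨ x 1 = 1) : x ∈ frontier Ω := by
  have hopen : IsOpenMap (EuclideanSpace.proj (1 : Fin 2) : Plane →L[ℝ] ℝ) :=
    ContinuousLinearMap.isOpenMap _ fun r ↦ ⟨!₂[0, r], by simp⟩
  have hΩ : Ω = (EuclideanSpace.proj (1 : Fin 2) : Plane →L[ℝ] ℝ) ⁻¹' Icc 0 1 := by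
    ext x; simp [Ω, closedStrip]
  rw [hΩ, ← hopen.preimage_frontier_eq_frontier_preimage (ContinuousLinearMap.continuous _),
    frontier_Icc zero_le_one]
  simpa using hx

lemma mem_interior_Ω {x : Plane} (h0 : 0 < x 1) (h1 : x 1 < 1) : x ∈ interior Ω :=
  mem_interior_iff_mem_nhds.2 (closedStrip_mem_nhds h0 h1)

lemma laplacian_plane (Φ : Plane → ℝ) (x : Plane) : (Laplacian.laplacian Φ : Plane → ℝ) x =
    fderiv ℝ (fderiv ℝ Φ) x e₁ e₁ + fderiv ℝ (fderiv ℝ Φ) x e₂ e₂ := by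
  have h0 : EuclideanSpace.basisFun (Fin 2) ℝ 0 = e₁ := plane_ext (by simp) (by simp)
  have h1 : EuclideanSpace.basisFun (Fin 2) ℝ 1 = e₂ := plane_ext (by simp) (by simp)
  rw [InnerProductSpace.laplacian_eq_iteratedFDeriv_orthonormalBasis Φ
    (EuclideanSpace.basisFun (Fin 2) ℝ)]
  simp only [Fin.sum_univ_two, iteratedFDeriv_two_apply, h0, h1, Matrix.cons_val_zero,
    Matrix.cons_val_one]

lemma perpGradient_eq (s : Set Plane) (Φ : Plane → ℝ) (x : Plane) :
    perpGradient s Φ x = pt (-(fderivWithin ℝ Φ s x e₂), fderivWithin ℝ Φ s x e₁) :=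
  (pt_eq _ _).symm

namespace IsStreamFunction

variable {v : Plane → Plane} {Φ : Plane → ℝ}

section
variable {f : Plane → ℝ} (hΦ : IsStreamFunction f Φ)
include hΦ

lemma eq_zero {x : Plane} (hx : x 1 = 0 ∨ x 1 = 1) : Φ x = 0 := hΦ.boundary x (mem_frontier_Ω hx)

lemma continuousOn_perpGradient : ContinuousOn (perpGradient Ω Φ) Ω := by
  have hc := hΦ.contDiffOn.continuousOn_fderivWithin (uniqueDiffOn_closedStrip one_pos) (by norm_num)
  have hc' := fun w : Plane ↦ hc.clm_apply (continuousOn_const (c := w))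
  exact (pt.continuous.comp_continuousOn ((hc' e₂).neg.prodMk (hc' e₁))).congr
    fun x _ ↦ perpGradient_eq Ω Φ x

/-- The second component is ∂₁Φ, a tangential derivative of a function that vanishes along the
bottom. -/
lemma perpGradient_bottom {x : Plane} (hx : x 1 = 0) : perpGradient Ω Φ x 1 = 0 := by
  have hmem : ∀ r : ℝ, x + r • e₁ ∈ Ω := fun r ↦ by simp [Ω, closedStrip, hx]
  have hd : HasFDerivWithinAt Φ (fderivWithin ℝ Φ Ω (x + (0 : ℝ) • e₁)) Ω (x + (0 : ℝ) • e₁) :=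
    (hΦ.contDiffOn.differentiableOn (by norm_num) _ (hmem 0)).hasFDerivWithinAt
  have hl : HasDerivAt (fun r : ℝ ↦ x + r • e₁) e₁ 0 := by
    simpa using ((hasDerivAt_id (0 : ℝ)).smul_const e₁).const_add x
  have h1 := hd.comp_hasDerivWithinAt (0 : ℝ) hl.hasDerivWithinAt (t := Ω) (s := univ)
    fun r _ ↦ hmem r
  rw [hasDerivWithinAt_univ] at h1
  have h0 : (Φ ∘ fun r : ℝ ↦ x + r • e₁) = fun _ ↦ 0 := by
    ext r
    exact hΦ.eq_zero (Or.inl (by simp [hx]))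
  rw [h0] at h1
  have := h1.unique (hasDerivAt_const 0 0)
  rw [zero_smul, add_zero] at this
  rw [perpGradient_eq, pt_apply_one]
  exact this

open scoped Pointwise in
lemma perpGradient_periodic {x : Plane} : perpGradient Ω Φ (x + period) = perpGradient Ω Φ x := by
  have hset : period +ᵥ Ω = Ω := by
    ext y
    rw [mem_vadd_set_iff_neg_vadd_mem]
    simp [Ω, closedStrip]
  have h := fderivWithin_comp_add_right (𝕜 := ℝ) (f := Φ) (s := Ω) (x := x) period
  have hf : (fun y ↦ Φ (y + period)) = Φ := funext hΦ.periodic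
  rw [hf, hset] at h
  rw [perpGradient_eq, perpGradient_eq, h]

end

variable (hΦ : IsStreamFunction (vorticity v) Φ)
include hΦ

/-- In the interior of `Ω`, the velocity error is free of divergence and vorticity. -/
lemma exists_hasFDerivAt_velocityError {x : Plane} (h0 : 0 < x 1) (h1 : x 1 < 1)
    (hv : DifferentiableAt ℝ v x) (hdiv : divergence v x = 0) :
    ∃ L : Plane →L[ℝ] Plane, HasFDerivAt (velocityError v Φ) L x ∧
      L e₁ 0 + L e₂ 1 = 0 ∧ L e₁ 1 - L e₂ 0 = 0 := by
  have hat : ContDiffAt ℝ 2 Φ x :=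
    hΦ.contDiffOn_interior.contDiffAt (isOpen_interior.mem_nhds (mem_interior_Ω h0 h1))
  have hd : HasFDerivAt (fderiv ℝ Φ) (fderiv ℝ (fderiv ℝ Φ) x) x :=
    ((hat.fderiv_right (m := 1) (by norm_num)).differentiableAt (by norm_num)).hasFDerivAt
  have hd' : ∀ w : Plane, HasFDerivAt (fun y ↦ fderiv ℝ Φ y w)
      ((fderiv ℝ (fderiv ℝ Φ) x).flip w) x := fun w ↦ by
    simpa using hd.clm_apply (hasFDerivAt_const w x)
  have hU : HasFDerivAt (fun y ↦ pt (-(fderiv ℝ Φ y e₂), fderiv ℝ Φ y e₁))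
      ((pt : ℝ × ℝ →L[ℝ] Plane).comp ((-(fderiv ℝ (fderiv ℝ Φ) x).flip e₂).prod
        ((fderiv ℝ (fderiv ℝ Φ) x).flip e₁))) x :=
    pt.hasFDerivAt.comp x ((hd' e₂).neg.prodMk (hd' e₁))
  have hev : perpGradient Ω Φ =ᶠ[𝓝 x] fun y ↦ pt (-(fderiv ℝ Φ y e₂), fderiv ℝ Φ y e₁) := by
    filter_upwards [isOpen_interior.mem_nhds (mem_interior_Ω h0 h1)] with y hy
    rw [perpGradient_eq, fderivWithin_of_mem_nhds (mem_interior_iff_mem_nhds.1 hy)]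
  have hU' := HasFDerivAt.congr_of_eventuallyEq hU hev
  refine ⟨_, hv.hasFDerivAt.sub hU', ?_, ?_⟩
  · have hsymm := hat.isSymmSndFDerivAt (by simp) e₁ e₂
    rw [divergence] at hdiv
    simp [hsymm]
    linarith
  · have hlap := hΦ.laplacian_eq x (mem_interior_Ω h0 h1)
    rw [laplacian_plane, vorticity] at hlap
    simp
    linarith

section
variable (hv : ContinuousOn v Ω)
include hv

lemma continuousOn_velocityError : ContinuousOn (velocityError v Φ) Ω :=
  hv.sub hΦ.continuousOn_perpGradient

variable (hvd : ∀ x : Plane, 0 < x 1 → x 1 < 1 → DifferentiableAt ℝ v x)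
  (hdiv : ∀ x : Plane, 0 < x 1 → x 1 < 1 → divergence v x = 0)
  (hper : Function.Periodic v period)
include hvd hdiv hper

/-- The velocity error is orthogonal to the approximate velocity. -/
lemma integral_inner_velocityError :
    ∫ x in box 1, inner ℝ (velocityError v Φ x) (perpGradient Ω Φ x) = 0 := by
  have hc := hΦ.continuousOn_velocityError hv
  have hci := fun i : Fin 2 ↦ (continuous_coord i).comp_continuousOn hc
  have hU := hΦ.continuousOn_perpGradient
  have hΦc := hΦ.contDiffOn.continuousOn
  have hΦd : ∀ x : Plane, 0 < x 1 → x 1 < 1 → HasFDerivAt Φ (fderiv ℝ Φ x) x := by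
    intro x h0 h1
    exact ((hΦ.contDiffOn_interior.contDiffAt (isOpen_interior.mem_nhds (mem_interior_Ω h0 h1))
      ).differentiableAt (by norm_num)).hasFDerivAt
  choose! L hL hL1 hL2 using fun (x : Plane) (h0 : 0 < x 1) (h1 : x 1 < 1) ↦
    hΦ.exists_hasFDerivAt_velocityError h0 h1 (hvd x h0 h1) (hdiv x h0 h1)
  -- The field Φ·(e₂, −e₁) has divergence e · ∇^⊥Φ + Φ(∂₁e₂ − ∂₂e₁), whose last term vanishes, and
  -- its flux is zero because Φ = 0 on both edges.
  rw [integral_divergence_box one_pos (F := fun x ↦ Φ x * velocityError v Φ x 1)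
    (G := fun x ↦ -(Φ x * velocityError v Φ x 0)) (hΦc.mul (hci 1)) (hΦc.mul (hci 0)).neg ?_
    (fun x h0 h1 ↦ (hΦd x h0 h1).mul (hasFDerivAt_coord (hL x h0 h1) 1))
    (fun x h0 h1 ↦ ((hΦd x h0 h1).mul (hasFDerivAt_coord (hL x h0 h1) 0)).neg) (hc.inner hU)]
  · have h0 : ∀ α : ℝ, Φ !₂[α, 0] = 0 := fun α ↦ hΦ.eq_zero (Or.inl (by simp))
    have h1 : ∀ α : ℝ, Φ !₂[α, 1] = 0 := fun α ↦ hΦ.eq_zero (Or.inr (by simp))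
    simp [h0, h1]
  · intro x h0 h1
    have hU' : perpGradient Ω Φ x = pt (-(fderiv ℝ Φ x e₂), fderiv ℝ Φ x e₁) := by
      have hmem : Ω ∈ 𝓝 x := closedStrip_mem_nhds h0 h1
      rw [perpGradient_eq, fderivWithin_of_mem_nhds hmem]
    rw [inner_plane, hU']
    simp only [pt_apply_zero, pt_apply_one, add_apply, neg_apply, smul_apply,
      ContinuousLinearMap.comp_apply, coordL_apply, smul_eq_mul]
    linear_combination -Φ x * hL2 x h0 h1
  · intro y _
    have h : (!₂[1, y] : Plane) = !₂[-1, y] + period := by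
      rw [add_period_eq]; norm_num
    simp only [h, velocityError, hΦ.periodic _, hper _, hΦ.perpGradient_periodic]

/-- Pythagoras: e is an orthogonal summand of v. -/
lemma integral_norm_sq_velocityError_le :
    ∫ x in box 1, ‖velocityError v Φ x‖ ^ 2 ≤ ∫ x in box 1, ‖v x‖ ^ 2 := by
  have hc := hΦ.continuousOn_velocityError hv
  have hint : ∀ {f : Plane → ℝ}, ContinuousOn f Ω → IntegrableOn f (box 1) := fun hf ↦
    (hf.mono (box_subset 1)).integrableOn_compact (isCompact_box 1)
  have h1 : IntegrableOn (fun x ↦ ‖v x‖ ^ 2) (box 1) := hint (hv.norm.pow 2)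
  have h2 := (hint (hc.inner hΦ.continuousOn_perpGradient)).const_mul 2
  have h3 : ∫ x in box 1, (‖v x‖ ^ 2 -
      2 * inner ℝ (velocityError v Φ x) (perpGradient Ω Φ x)) = ∫ x in box 1, ‖v x‖ ^ 2 := by
    rw [integral_sub h1 h2, integral_const_mul,
      hΦ.integral_inner_velocityError hv hvd hdiv hper, mul_zero, sub_zero]
  rw [← h3]
  refine integral_mono (hint (hc.norm.pow 2)) (h1.sub h2) fun x ↦ ?_
  have h4 : v x = velocityError v Φ x + perpGradient Ω Φ x := by simp [velocityError]
  simp only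
  conv_rhs => rw [h4]
  rw [norm_add_sq_real]
  nlinarith [sq_nonneg ‖perpGradient Ω Φ x‖]

end

end IsStreamFunction

/-! ### The complex velocity -/

/-- The identification of `ℂ` with the plane. -/
def complexPlane : ℂ ≃L[ℝ] Plane := Complex.equivRealProdCLM.trans pt

@[simp] lemma complexPlane_zero (z : ℂ) : complexPlane z 0 = z.re := by simp [complexPlane]
@[simp] lemma complexPlane_one (z : ℂ) : complexPlane z 1 = z.im := by simp [complexPlane]

@[simp] lemma complexPlane_symm_re (x : Plane) : (complexPlane.symm x).re = x 0 := by
  rw [← complexPlane_zero, ContinuousLinearEquiv.apply_symm_apply]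

@[simp] lemma complexPlane_symm_im (x : Plane) : (complexPlane.symm x).im = x 1 := by
  rw [← complexPlane_one, ContinuousLinearEquiv.apply_symm_apply]

@[simp] lemma norm_complexPlane (z : ℂ) : ‖complexPlane z‖ = ‖z‖ := by
  rw [← sq_eq_sq₀ (norm_nonneg _) (norm_nonneg _), norm_sq_plane, Complex.sq_norm,
    Complex.normSq_apply]
  simp [sq]

@[simp] lemma norm_complexPlane_symm (x : Plane) : ‖complexPlane.symm x‖ = ‖x‖ := by
  rw [← norm_complexPlane, ContinuousLinearEquiv.apply_symm_apply]

lemma complexPlane_one' : complexPlane 1 = e₁ := plane_ext (by simp) (by simp)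
lemma complexPlane_I : complexPlane Complex.I = e₂ := plane_ext (by simp) (by simp)

lemma measurePreserving_complexPlane : MeasurePreserving complexPlane volume volume :=
  measurePreserving_pt.comp Complex.volume_preserving_equiv_real_prod

lemma measurableEmbedding_complexPlane : MeasurableEmbedding complexPlane :=
  complexPlane.toHomeomorph.measurableEmbedding

open ComplexConjugate in
/-- The complex velocity `e₁ - i e₂`. -/
def complexVelocity (e : Plane → Plane) (z : ℂ) : ℂ := conj (complexPlane.symm (e (complexPlane z)))

lemma norm_complexVelocity (e : Plane → Plane) (z : ℂ) :
    ‖complexVelocity e z‖ = ‖e (complexPlane z)‖ := by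
  simp [complexVelocity]

/-- Vanishing divergence and vorticity are the Cauchy–Riemann equations of e₁ − i e₂. -/
lemma differentiableAt_complexVelocity {e : Plane → Plane} {L : Plane →L[ℝ] Plane} {z : ℂ}
    (hL : HasFDerivAt e L (complexPlane z)) (h1 : L e₁ 0 + L e₂ 1 = 0)
    (h2 : L e₁ 1 - L e₂ 0 = 0) : DifferentiableAt ℂ (complexVelocity e) z := by
  have h : HasFDerivAt (complexVelocity e) _ z :=
    Complex.conjCLE.hasFDerivAt.comp z (complexPlane.symm.hasFDerivAt.comp z
      (hL.comp z complexPlane.hasFDerivAt))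
  rw [differentiableAt_complex_iff_differentiableAt_real]
  refine ⟨h.differentiableAt, ?_⟩
  rw [h.fderiv]
  apply Complex.ext
  · simp [complexPlane_one', complexPlane_I]
    linarith
  · simp [complexPlane_one', complexPlane_I]
    linarith

open ComplexConjugate in
/-- Recovers a velocity field from its complex velocity. -/
def ofComplexVelocity (h : ℂ → ℂ) (x : Plane) : Plane :=
  complexPlane (conj (h (complexPlane.symm x)))

lemma ofComplexVelocity_complexVelocity (e : Plane → Plane) (x : Plane) :
    ofComplexVelocity (complexVelocity e) x = e x := by
  simp [ofComplexVelocity, complexVelocity]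

lemma complexPlane_symm_mem_ball {x : Plane} {r : ℝ} :
    complexPlane.symm x ∈ Metric.ball (0 : ℂ) r ↔ x ∈ Metric.ball (0 : Plane) r := by
  simp

lemma contDiffOn_ofComplexVelocity {h : ℂ → ℂ} {r : ℝ}
    (hh : DifferentiableOn ℂ h (Metric.ball 0 r)) :
    ContDiffOn ℝ ∞ (ofComplexVelocity h) (Metric.ball 0 r) := by
  have h1 : ContDiffOn ℝ ∞ h (Metric.ball 0 r) :=
    (hh.contDiffOn (n := ∞) Metric.isOpen_ball).restrict_scalars ℝ
  refine complexPlane.contDiff.comp_contDiffOn (Complex.conjCLE.contDiff.comp_contDiffOn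
    (h1.comp complexPlane.symm.contDiff.contDiffOn fun x hx ↦ ?_))
  exact complexPlane_symm_mem_ball.2 hx

lemma norm_fderiv_ofComplexVelocity_le {h : ℂ → ℂ} {x : Plane}
    (hh : DifferentiableAt ℂ h (complexPlane.symm x)) :
    ‖fderiv ℝ (ofComplexVelocity h) x‖ ≤ ‖deriv h (complexPlane.symm x)‖ := by
  have hd : HasFDerivAt (ofComplexVelocity h) _ x :=
    complexPlane.hasFDerivAt.comp x (Complex.conjCLE.hasFDerivAt.comp x
      ((hh.hasDerivAt.hasFDerivAt.restrictScalars ℝ).comp x complexPlane.symm.hasFDerivAt))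
  rw [hd.fderiv]
  refine ContinuousLinearMap.opNorm_le_bound _ (norm_nonneg _) fun w ↦ ?_
  simp [mul_comm]

open ComplexConjugate in
-- The upper part of the disk and the mirror image of the lower part both lie in `box 1`, and
-- reflection preserves modulus and area; hence the factor 2.
lemma integral_ball_norm_sq_schwarzReflection_le {e : Plane → Plane} (he : ContinuousOn e Ω)
    (hd : DifferentiableOn ℂ (schwarzReflection (complexVelocity e)) (Metric.ball 0 1)) {w : ℂ}
    (hw : w ∈ Metric.closedBall (0 : ℂ) (5 / 8)) :
    ∫ z in Metric.ball w (1 / 4), ‖schwarzReflection (complexVelocity e) z‖ ^ 2 ≤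
      2 * ∫ x in box 1, ‖e x‖ ^ 2 := by
  have hball : Metric.closedBall w (1 / 4) ⊆ Metric.ball (0 : ℂ) 1 := by
    refine Metric.closedBall_subset_ball' ?_
    rw [mem_closedBall_iff_norm, sub_zero] at hw
    rw [dist_zero_right]
    linarith
  have hnorm : ∀ z ∈ Metric.ball w (1 / 4), |z.re| < 1 ∧ |z.im| < 1 := by
    intro z hz
    have := hball (Metric.ball_subset_closedBall hz)
    rw [mem_ball_zero_iff] at this
    exact ⟨(Complex.abs_re_le_norm z).trans_lt this, (Complex.abs_im_le_norm z).trans_lt this⟩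
  have hupper : ∀ S : Set ℂ, MapsTo complexPlane S (box 1) →
      ∫ z in S, ‖e (complexPlane z)‖ ^ 2 ≤ ∫ x in box 1, ‖e x‖ ^ 2 := by
    intro S hS
    have hint : IntegrableOn (fun x ↦ ‖e x‖ ^ 2) (box 1) :=
      ((he.mono (box_subset 1)).norm.pow 2).integrableOn_compact (isCompact_box 1)
    rw [← measurePreserving_complexPlane.setIntegral_preimage_emb measurableEmbedding_complexPlane]
    refine setIntegral_mono_set ?_ (ae_of_all _ fun z ↦ sq_nonneg _) (LE.le.eventuallyLE hS)
    exact (measurePreserving_complexPlane.integrableOn_comp_preimage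
      measurableEmbedding_complexPlane).2 hint
  have hint : IntegrableOn (fun z ↦ ‖schwarzReflection (complexVelocity e) z‖ ^ 2)
      (Metric.ball w (1 / 4)) :=
    (((hd.continuousOn.mono hball).norm.pow 2).integrableOn_compact
      (isCompact_closedBall w (1 / 4))).mono_set Metric.ball_subset_closedBall
  have hP : MeasurableSet {z : ℂ | 0 ≤ z.im} :=
    (isClosed_le continuous_const Complex.continuous_im).measurableSet
  rw [← integral_inter_add_sdiff hP hint, two_mul]
  refine add_le_add ?_ ?_
  · rw [setIntegral_congr_fun (g := fun z ↦ ‖e (complexPlane z)‖ ^ 2)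
      (measurableSet_ball.inter hP) fun z hz ↦ by
        simp only [schwarzReflection_of_nonneg (h := complexVelocity e) hz.2, norm_complexVelocity]]
    refine hupper _ fun z hz ↦ ?_
    have h1 := hnorm z hz.1
    rw [abs_lt, abs_lt] at h1
    have h2 : 0 ≤ z.im := hz.2
    exact ⟨⟨by simpa using h1.1.1.le, by simpa using h1.1.2.le⟩, by simpa using h2,
      by simpa using h1.2.2.le⟩
  · rw [setIntegral_congr_fun (g := fun z ↦ ‖e (complexPlane (conj z))‖ ^ 2)
      (measurableSet_ball.diff hP) fun z hz ↦ by
        simp only [schwarzReflection_conj (h := complexVelocity e) (not_le.1 hz.2),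
          RCLike.norm_conj, norm_complexVelocity]]
    -- The lower part is written as a preimage under conjugation so that the change of variables
    -- moves the integral to the upper half plane.
    have hcc : Metric.ball w (1 / 4) \ {z : ℂ | 0 ≤ z.im} =
        Complex.conjLIE ⁻¹' (Complex.conjLIE ⁻¹' (Metric.ball w (1 / 4) \ {z : ℂ | 0 ≤ z.im})) := by
      ext z
      simp
    rw [hcc]
    have := (Complex.conjLIE.measurePreserving).setIntegral_preimage_emb
      Complex.conjLIE.toHomeomorph.measurableEmbedding (fun z ↦ ‖e (complexPlane z)‖ ^ 2)
      (Complex.conjLIE ⁻¹' (Metric.ball w (1 / 4) \ {z : ℂ | 0 ≤ z.im}))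
    refine le_of_eq_of_le this (hupper _ fun z hz ↦ ?_)
    have h1 := hnorm _ hz.1
    have h2 : ¬ 0 ≤ (Complex.conjLIE z).im := hz.2
    rw [abs_lt, abs_lt] at h1
    simp only [Complex.conjLIE_apply, Complex.conj_re, Complex.conj_im] at h1 h2
    exact ⟨⟨by simpa using h1.1.1.le, by simpa using h1.1.2.le⟩, by simp; linarith,
      by simp; linarith⟩

/-- Interior regularity up to the flat boundary for vector fields without divergence and vorticity
that are tangential to that boundary. -/
theorem exists_contDiffOn_eq_of_harmonic {e : Plane → Plane} (he : ContinuousOn e Ω)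
    (hd : ∀ x : Plane, 0 < x 1 → x 1 < 1 → ∃ L : Plane →L[ℝ] Plane, HasFDerivAt e L x ∧
      L e₁ 0 + L e₂ 1 = 0 ∧ L e₁ 1 - L e₂ 0 = 0)
    (hbot : ∀ x : Plane, x 1 = 0 → e x 1 = 0) :
    ∃ E : Plane → Plane, ContDiffOn ℝ ∞ E (Metric.ball 0 1) ∧
      EqOn e E (Metric.ball 0 1 ∩ Ω) ∧ ∀ x ∈ Metric.ball (0 : Plane) (1 / 2),
        ‖fderiv ℝ E x‖ ≤ 24 * √(2 * ∫ x in box 1, ‖e x‖ ^ 2) := by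
  have him : ∀ z ∈ Metric.ball (0 : ℂ) 1, z.im < 1 := fun z hz ↦
    (le_abs_self _).trans_lt ((Complex.abs_im_le_norm z).trans_lt (mem_ball_zero_iff.1 hz))
  have hc : ContinuousOn (complexVelocity e) (Metric.ball 0 1 ∩ {z | 0 ≤ z.im}) := by
    refine Complex.continuous_conj.comp_continuousOn (complexPlane.symm.continuous.comp_continuousOn
      (he.comp complexPlane.continuous.continuousOn fun z hz ↦ ?_))
    have h2 : 0 ≤ z.im := hz.2
    exact ⟨by simpa using h2, by simpa using (him z hz.1).le⟩
  have hdiff : DifferentiableOn ℂ (schwarzReflection (complexVelocity e)) (Metric.ball 0 1) := by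
    refine differentiableOn_schwarzReflection hc (fun z hz h0 ↦ ?_) fun z _ h0 ↦ ?_
    · obtain ⟨L, hL, h1, h2⟩ := hd (complexPlane z) (by simpa using h0) (by simpa using him z hz)
      exact differentiableAt_complexVelocity hL h1 h2
    -- On the real axis the imaginary part of e₁ − i e₂ is −e₂ = 0.
    · simp [complexVelocity, hbot (complexPlane z) (by simpa using h0)]
  refine ⟨ofComplexVelocity (schwarzReflection (complexVelocity e)),
    contDiffOn_ofComplexVelocity hdiff, fun x hx ↦ ?_, fun x hx ↦ ?_⟩
  · have h0 : 0 ≤ (complexPlane.symm x).im := by simpa using hx.2.1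
    rw [ofComplexVelocity, schwarzReflection_of_nonneg h0]
    exact (ofComplexVelocity_complexVelocity e x).symm
  · have hx' := complexPlane_symm_mem_ball.2 hx
    have hx1 : complexPlane.symm x ∈ Metric.ball (0 : ℂ) 1 :=
      Metric.ball_subset_ball (by norm_num) hx'
    refine (norm_fderiv_ofComplexVelocity_le
      (hdiff.differentiableAt (Metric.isOpen_ball.mem_nhds hx1))).trans ?_
    refine norm_deriv_le_of_integral_ball_le ?_ hdiff
      (fun w hw ↦ integral_ball_norm_sq_schwarzReflection_le he hdiff hw) hx'
    exact mul_nonneg zero_le_two (integral_nonneg fun x ↦ sq_nonneg _)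

/-- The half disk has unique differentials at its flat boundary points too, so the derivative within
it is that of the smooth extension. -/
lemma fderivWithin_eq_fderiv_of_eqOn {e E : Plane → Plane} {x : Plane}
    (hE : ContDiffOn ℝ ∞ E (Metric.ball 0 1)) (heq : EqOn e E (Metric.ball 0 1 ∩ Ω))
    (hx : x ∈ Metric.ball (0 : Plane) (1 / 2) ∩ Ω) :
    fderivWithin ℝ e (Metric.ball (0 : Plane) (1 / 2) ∩ Ω) x = fderiv ℝ E x := by
  have hb : Metric.ball (0 : Plane) (1 / 2) ⊆ Metric.ball 0 1 :=
    Metric.ball_subset_ball (by norm_num)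
  have hsub : Metric.ball (0 : Plane) (1 / 2) ∩ Ω ⊆ Metric.ball 0 1 ∩ Ω :=
    inter_subset_inter_left _ hb
  have hdE : DifferentiableAt ℝ E x :=
    (hE.contDiffAt (Metric.isOpen_ball.mem_nhds (hb hx.1))).differentiableAt (by norm_num)
  rw [fderivWithin_congr (heq.mono hsub) (heq (hsub hx))]
  refine hdE.fderivWithin ?_
  exact (uniqueDiffOn_closedStrip one_pos x hx.2).inter' (mem_nhdsWithin_of_mem_nhds
    (Metric.isOpen_ball.mem_nhds hx.1)) |>.mono (inter_comm _ _).subset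

lemma closure_ball_inter_Ω_subset :
    closure (Metric.ball (0 : Plane) (1 / 2) ∩ Ω) ⊆ Metric.ball 0 1 ∩ Ω := by
  refine (closure_minimal (t := Metric.closedBall (0 : Plane) (1 / 2) ∩ Ω)
    (inter_subset_inter_left _ Metric.ball_subset_closedBall)
    (Metric.isClosed_closedBall.inter (isClosed_closedStrip 1))).trans ?_
  exact inter_subset_inter_left _ (Metric.closedBall_subset_ball (by norm_num))

end FreeBoundaryEuler

end

/-! ### The gradient estimate for the velocity error -/

theorem proposition3p2 :
    ∃ C : ℝ, 0 < C ∧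
      ∀ (σ T : ℝ) (u : ℝ → Plane → Plane) (p : ℝ → Plane → ℝ) (η : ℝ → Plane → Plane),
        0 < σ → 0 < T → IsSolution σ T u p η →
        ContDiffOn ℝ ∞ (u 0) initialDomain →
        kineticEnergy u η 0 ≤ σ / 20 →
        ∀ t ∈ Ico 0 T,
          Ω ⊆ closedFluidDomain η t ∧
          ∀ Φ : Plane → ℝ, IsStreamFunction (vorticity (u t)) Φ →
            ContDiffOn ℝ ∞ (velocityError (u t) Φ) (closure (Metric.ball 0 (1 / 2) ∩ Ω)) ∧
            ∀ x ∈ Metric.ball (0 : Plane) (1 / 2) ∩ Ω,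
              ‖fderivWithin ℝ (velocityError (u t) Φ) (Metric.ball 0 (1 / 2) ∩ Ω) x‖
                ≤ C * √(kineticEnergy u η 0) := by
  -- 48 = 24 · 2: the interior estimate contributes 24, and the reflected L² norm squared is at most
  -- 2 · 2K(0), whose root is 2√K(0).
  refine ⟨48, by norm_num, fun σ T u p η hσ _ hs _ hK t ht ↦
    ⟨hs.Ω_subset_closedFluidDomain hσ hK ht, fun Φ hΦ ↦ ?_⟩⟩
  have hstrip := hs.strip_subset_fluidDomain hσ hK ht
  have hv := (hs.velocity_contDiffOn_space t ht).continuousOn.mono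
    (hs.Ω_subset_closedFluidDomain hσ hK ht)
  have hvd : ∀ x : Plane, 0 < x 1 → x 1 < 1 → DifferentiableAt ℝ (u t) x := fun x h0 h1 ↦
    ((hs.velocity_contDiffOn_space t ht).contDiffAt (Filter.mem_of_superset
      ((hs.motion.isOpen_fluidDomain ht).mem_nhds (hstrip ⟨h0, h1.le⟩))
      fluidDomain_subset)).differentiableAt (by norm_num)
  have hdiv : ∀ x : Plane, 0 < x 1 → x 1 < 1 → divergence (u t) x = 0 := fun x h0 h1 ↦
    hs.incompressible t ht x (hstrip ⟨h0, h1.le⟩)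
  obtain ⟨E, hE, heq, hbound⟩ := exists_contDiffOn_eq_of_harmonic
    (hΦ.continuousOn_velocityError hv)
    (fun x h0 h1 ↦ hΦ.exists_hasFDerivAt_velocityError h0 h1 (hvd x h0 h1) (hdiv x h0 h1))
    (fun x hx ↦ by simp [velocityError, hs.no_flow t ht x hx, hΦ.perpGradient_bottom hx])
  refine ⟨(hE.mono (closure_ball_inter_Ω_subset.trans inter_subset_left)).congr
    (heq.mono closure_ball_inter_Ω_subset), fun x hx ↦ ?_⟩
  rw [fderivWithin_eq_fderiv_of_eqOn hE heq hx]
  refine (hbound x hx.1).trans ?_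
  have h1 := (hΦ.integral_norm_sq_velocityError_le hv hvd hdiv
    (hs.velocity_periodic t ht)).trans (hs.integral_norm_sq_velocity_le hσ hK ht)
  have h2 : √(2 * ∫ x in box 1, ‖velocityError (u t) Φ x‖ ^ 2) ≤
      2 * √(kineticEnergy u η 0) := by
    rw [show (2 : ℝ) * √(kineticEnergy u η 0) = √(2 ^ 2 * kineticEnergy u η 0) by
      rw [Real.sqrt_mul (by norm_num), Real.sqrt_sq (by norm_num)]]
    exact Real.sqrt_le_sqrt (by linarith)
  linarith
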